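/- Fix a countable set of actions $\alpha,\beta,\dots$. \emph{Finite processes} and \emph{processes} are given by $$F ::= 0 \mid \alpha.F \mid F|F, \qquad P,Q ::= F \mid\; !\alpha.F \mid P|P,$$ and single-hole contexts (to be filled with finite processes) by $$D ::= [\,] \mid \alpha.D \mid D|F, \qquad C ::= D \mid\; !\alpha.D \mid C|P .$$ Transitions are generated by the rules: $\alpha.F\xrightarrow{\alpha}F$; $\;!\alpha.F\xrightarrow{\alpha}\;!\alpha.F|F$; if $P\xrightarrow{\alpha}P'$ then $P|Q\xrightarrow{\alpha}P'|Q$ and $Q|P\xrightarrow{\alpha}Q|P'$ (there is no synchronisation). Strong bisimilarity $\sim$ is the largest relation such that $P\sim Q$ implies: for each $P\xrightarrow{\alpha}P'$ there is $Q\xrightarrow{\alpha}Q'$ with $P'\sim Q'$, and conversely for each $Q\xrightarrow{\alpha}Q'$ there is $P\xrightarrow{\alpha}P'$ with $P'\sim Q'$. Let $\equiv$ be the smallest congruence on processes containing the laws of an abelian monoid for $|$ with neutral element $0$, and the distribution law $$\alpha.(F\,|\,\alpha.F\,|\cdots|\,\alpha.F) = \alpha.F\,|\,\alpha.F\,|\cdots|\,\alpha.F$$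 with equally many (at least one) occurrences of $F$ on both sides. Each process $T$ induces a relation $\to_T$ on processes, defined by the following axioms, where $C,\alpha,F,P,T$ are arbitrary: $$\text{(B1)}\quad C[\alpha.F]\to_{T} C[0]\ \text{ if } T=\;!\alpha.F|P, \qquad \text{(B2)}\quad !\alpha.F\,|\,!\alpha.F\,|\,P\to_T\; !\alpha.F\,|\,P ,$$ all taken modulo $\equiv$ (for the index $T$ and for both related processes). Let $\to_T^*$ be the reflexive transitive closure of $\to_T$, also modulo $\equiv$ (so $P\equiv Q$ implies $P\to_T^*Q$). Processes $P$ and $Q$ are \emph{convertible} if there is a process $T$ with $P\to_T^*T$ and $Q\to_T^*T$. \textbf{Theorem.} For all processes $P$ and $Q$: $P$ and $Q$ are convertible if and only if $P\sim Q$. -/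

import Mathlib

namespace CCS

/-- Finite processes `F ::= 0 | α.F | F|F` over a set `A` of actions. -/
inductive FProc (A : Type*) where
  | nil : FProc A
  | pre : A → FProc A → FProc A
  | par : FProc A → FProc A → FProc A

/-- Processes `P ::= F | !α.F | P|P`.  Unfolding the grammar of the finite processes `F` makes this
`P ::= 0 | α.F | !α.F | P|P`, so that every process has exactly one syntax tree; the inclusion of
the finite processes is `FProc.toProc`. -/
inductive Proc (A : Type*) where
  | nil : Proc A
  | pre : A → FProc A → Proc A
  | rep : A → FProc A → Proc A
  | par : Proc A → Proc A → Proc A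

/-- A finite process, seen as a process. -/
def FProc.toProc {A : Type*} : FProc A → Proc A
  | .nil => .nil
  | .pre a F => .pre a F
  | .par F G => .par F.toProc G.toProc

/-- Single-hole finite contexts `D ::= [] | α.D | D|F`. -/
inductive FCtx (A : Type*) where
  | hole : FCtx A
  | pre : A → FCtx A → FCtx A
  | par : FCtx A → FProc A → FCtx A

/-- Single-hole contexts `C ::= D | !α.D | C|P`. -/
inductive Ctx (A : Type*) where
  | fin : FCtx A → Ctx A
  | rep : A → FCtx A → Ctx A
  | par : Ctx A → Proc A → Ctx A

/-- The finite process `D[F]`. -/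
def FCtx.fill {A : Type*} : FCtx A → FProc A → FProc A
  | .hole, F => F
  | .pre a D, F => .pre a (D.fill F)
  | .par D G, F => .par (D.fill F) G

/-- The process `C[F]`. -/
def Ctx.fill {A : Type*} : Ctx A → FProc A → Proc A
  | .fin D, F => (D.fill F).toProc
  | .rep a D, F => .rep a (D.fill F)
  | .par C P, F => .par (C.fill F) P

/-- The labelled transition system. -/
inductive Step {A : Type*} : Proc A → A → Proc A → Prop
  | pre (a : A) (F : FProc A) : Step (.pre a F) a F.toProc
  | rep (a : A) (F : FProc A) : Step (.rep a F) a (.par (.rep a F) F.toProc)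
  | parL {a : A} {P P' : Proc A} (Q : Proc A) :
      Step P a P' → Step (.par P Q) a (.par P' Q)
  | parR {a : A} {Q Q' : Proc A} (P : Proc A) :
      Step Q a Q' → Step (.par P Q) a (.par P Q')

/-- `R` is a strong bisimulation. -/
def IsBisimulation {A : Type*} (R : Proc A → Proc A → Prop) : Prop :=
  ∀ P Q, R P Q →
    (∀ a P', Step P a P' → ∃ Q', Step Q a Q' ∧ R P' Q') ∧
    (∀ a Q', Step Q a Q' → ∃ P', Step P a P' ∧ R P' Q')

/-- Strong bisimilarity `P ∼ Q`. -/
def Bisimilar {A : Type*} (P Q : Proc A) : Prop :=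
  ∃ R : Proc A → Proc A → Prop, IsBisimulation R ∧ R P Q

/-- `F.parCopies G k` is `F | G | ⋯ | G` with `k` copies of `G`. -/
def FProc.parCopies {A : Type*} (F G : FProc A) : ℕ → FProc A
  | 0 => F
  | k + 1 => .par (F.parCopies G k) G

/-- The smallest congruence on processes that contains the laws of an abelian monoid for parallel
composition (with neutral element `0`) and the distribution law
`α.(F | α.F | ⋯ | α.F) = α.F | α.F | ⋯ | α.F`, with `k + 1` occurrences of `F` on both sides. -/
inductive EqD {A : Type*} : Proc A → Proc A → Prop
  | refl (P : Proc A) : EqD P P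
  | symm {P Q : Proc A} : EqD P Q → EqD Q P
  | trans {P Q R : Proc A} : EqD P Q → EqD Q R → EqD P R
  | pre (a : A) {F G : FProc A} : EqD F.toProc G.toProc → EqD (.pre a F) (.pre a G)
  | rep (a : A) {F G : FProc A} : EqD F.toProc G.toProc → EqD (.rep a F) (.rep a G)
  | par {P P' Q Q' : Proc A} : EqD P P' → EqD Q Q' → EqD (.par P Q) (.par P' Q')
  | par_nil (P : Proc A) : EqD (.par P .nil) P
  | par_comm (P Q : Proc A) : EqD (.par P Q) (.par Q P)
  | par_assoc (P Q R : Proc A) : EqD (.par (.par P Q) R) (.par P (.par Q R))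
  | distr (a : A) (F : FProc A) (k : ℕ) :
      EqD (.pre a (F.parCopies (.pre a F) k))
        ((FProc.pre a F).parCopies (.pre a F) k).toProc

/-- The two rewriting axioms; `Axm T P Q` means that `P` rewrites to `Q` under the index `T`. -/
inductive Axm {A : Type*} : Proc A → Proc A → Proc A → Prop
  | b1 (C : Ctx A) (a : A) (F : FProc A) (P : Proc A) :
      Axm (.par (.rep a F) P) (C.fill (.pre a F)) (C.fill .nil)
  | b2 (a : A) (F : FProc A) (P T : Proc A) :
      Axm T (.par (.par (.rep a F) (.rep a F)) P) (.par (.rep a F) P)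

/-- One rewriting step under the index `T`, modulo `EqD` (for the index as well). -/
def Rew {A : Type*} (T P Q : Proc A) : Prop :=
  ∃ T₀ P₀ Q₀ : Proc A, EqD T T₀ ∧ EqD P P₀ ∧ Axm T₀ P₀ Q₀ ∧ EqD Q₀ Q

/-- The reflexive transitive closure of `Rew T`, taken modulo `EqD`: any finite number of rewriting
steps and of replacements of a process by an `EqD`-equal one. -/
def Rews {A : Type*} (T : Proc A) : Proc A → Proc A → Prop :=
  Relation.ReflTransGen (fun P Q => EqD P Q ∨ Rew T P Q)

/-- `P` and `Q` are convertible. -/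
def Convertible {A : Type*} (P Q : Proc A) : Prop :=
  ∃ T : Proc A, Rews T P T ∧ Rews T Q T

end CCS

/-! Without synchronisation, a process is determined up to bisimilarity by a set `S` of replicated
prefixes, which transitions never change, and a finite part in the monoid `FClass` of finite
processes modulo bisimilarity (`bisimilar_iff`).

Finite layer: every class is a sum of indecomposables in a unique way (`ParallelLTS.eq_of_sum_eq`).
A prefix has only one transition, so it is a multiple of one indecomposable prefix
(`FClass.factors_pre`). The distribution law expresses just this, so ≡ is bisimilarity on finite
processes (`eqD_of_cls_eq`).

Replicated layer: `x` is absorbed by `S` if `RBis S S x 0`. Summands of absorbed elements are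
absorbed (`RBis.left_of_add`), hence bisimilar processes have bisimilar replicated parts
(`RBis.zero_zero`). A prefix α.x is absorbed iff `S` contains some !α.f with `x` and `f` bisimilar
beside `S` (`RBis.pre_zero_iff`). Finite processes without absorbed subterms that are bisimilar
beside `S` are bisimilar outright (`Reduced.cls_eq`).

Soundness: rewriting under the index T changes neither component up to bisimilarity beside the
replications of T. Since T is also the target, the source is bisimilar to T. Completeness: erase the
absorbed prefixes of P and Q, innermost first, and merge duplicate replications; both reach the same
T. Each erasure is an instance of (B1), because T contains the absorbing replications in reduced
form and matching reduced bodies are ≡-equal. -/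

namespace CCS

/-! ### Unique decomposition into indecomposables. -/

/-- A commutative monoid with a labelled transition relation in which sums run in parallel, every
transition decreases the size, and bisimilar elements are equal. -/
structure ParallelLTS (M A : Type*) [AddCommMonoid M] where
  step : M → A → M → Prop
  size : M →+ ℕ
  eq_zero_of_size : ∀ {x}, size x = 0 → x = 0
  size_lt : ∀ {x a y}, step x a y → size y < size x
  step_add : ∀ {x y a z}, step (x + y) a z ↔
    (∃ x', step x a x' ∧ z = x' + y) ∨ (∃ y', step y a y' ∧ z = x + y')
  ext : ∀ {x y}, (∀ a z, step x a z ↔ step y a z) → x = y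

/-- A nonzero element that is not a sum of two nonzero elements. -/
def Indecomposable {M : Type*} [AddCommMonoid M] (x : M) : Prop :=
  x ≠ 0 ∧ ∀ y z, x = y + z → y = 0 ∨ z = 0

namespace ParallelLTS

variable {M A : Type*} [AddCommMonoid M] (X : ParallelLTS M A)

include X

theorem not_step_zero {a : A} {z : M} : ¬ X.step 0 a z := fun h => by
  have := X.size_lt h
  simp at this

theorem exists_step {x : M} (hx : x ≠ 0) : ∃ a y, X.step x a y := by
  by_contra! h
  exact hx (X.ext fun a z => ⟨fun h' => absurd h' (h a z), fun h' => absurd h' X.not_step_zero⟩)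

theorem size_pos {x : M} (hx : x ≠ 0) : 0 < X.size x :=
  Nat.pos_of_ne_zero fun h => hx (X.eq_zero_of_size h)

theorem exists_factors (x : M) :
    ∃ s : Multiset M, (∀ p ∈ s, Indecomposable p) ∧ s.sum = x := by
  induction h : X.size x using Nat.strong_induction_on generalizing x with
  | _ n ih =>
    subst h
    by_cases hx : x = 0
    · exact ⟨0, by simp, by simp [hx]⟩
    by_cases hi : Indecomposable x
    · exact ⟨{x}, by simpa using hi, by simp⟩
    · simp only [Indecomposable, not_and, not_forall, not_or] at hi
      obtain ⟨y, z, rfl, hy, hz⟩ := hi hx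
      have h1 := X.size_pos hy
      have h2 := X.size_pos hz
      obtain ⟨s, hs, hs'⟩ := ih (X.size y) (by rw [map_add]; omega) y rfl
      obtain ⟨t, ht, ht'⟩ := ih (X.size z) (by rw [map_add]; omega) z rfl
      refine ⟨s + t, ?_, by simp [hs', ht']⟩
      intro p hp
      rcases Multiset.mem_add.1 hp with hp | hp
      exacts [hs p hp, ht p hp]

/-- A decomposition of `x` into indecomposable elements. -/
noncomputable def factors (x : M) : Multiset M := (X.exists_factors x).choose

theorem indecomposable_of_mem_factors {x p : M} (h : p ∈ X.factors x) : Indecomposable p :=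
  (X.exists_factors x).choose_spec.1 p h

theorem sum_factors (x : M) : (X.factors x).sum = x := (X.exists_factors x).choose_spec.2

theorem size_le_of_mem {s : Multiset M} {p : M} (h : p ∈ s) : X.size p ≤ X.size s.sum := by
  classical
  rw [← Multiset.cons_erase h, Multiset.sum_cons, map_add]
  omega

theorem not_mem_factors {x p : M} (h : X.size x < X.size p) : p ∉ X.factors x := fun hp => by
  have := X.size_le_of_mem hp
  rw [sum_factors] at this
  omega

theorem step_sum [DecidableEq M] {s : Multiset M} {a : A} {z : M} :
    X.step s.sum a z ↔ ∃ x ∈ s, ∃ x', X.step x a x' ∧ z = (s.erase x).sum + x' := by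
  constructor
  · induction s using Multiset.induction_on generalizing z with
    | empty => exact fun h => absurd h X.not_step_zero
    | cons p s ih =>
      rw [Multiset.sum_cons, X.step_add]
      rintro (⟨x', h, rfl⟩ | ⟨y', h, rfl⟩)
      · exact ⟨p, by simp, x', h, by simp [add_comm]⟩
      · obtain ⟨x, hx, x', hs, rfl⟩ := ih h
        refine ⟨x, by simp [hx], x', hs, ?_⟩
        rw [Multiset.erase_cons_tail_of_mem hx, Multiset.sum_cons, add_assoc]
  · rintro ⟨x, hx, x', h, rfl⟩
    rw [← Multiset.cons_erase hx, Multiset.sum_cons, X.step_add]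
    exact Or.inl ⟨x', h, by rw [Multiset.cons_erase hx, add_comm]⟩

/-- The combinatorial core of unique decomposition: two multisets of indecomposable elements whose
transitions simulate each other, as multisets, cannot first differ at `p`. -/
theorem count_le_of_matching [DecidableEq M] {s t : Multiset M}
    (hs : ∀ p ∈ s, Indecomposable p) (ht : ∀ p ∈ t, Indecomposable p)
    (hsum : s.sum = t.sum)
    (hst : ∀ x ∈ s, ∀ a x', X.step x a x' → ∃ y ∈ t, ∃ y', X.step y a y' ∧
      s.erase x + X.factors x' = t.erase y + X.factors y')
    (hts : ∀ y ∈ t, ∀ a y', X.step y a y' → ∃ x ∈ s, ∃ x', X.step x a x' ∧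
      s.erase x + X.factors x' = t.erase y + X.factors y')
    (p : M) (hp : ∀ q, X.size p < X.size q → s.count q = t.count q) :
    s.count p ≤ t.count p := by
  by_contra! hlt
  have hps : p ∈ s := Multiset.count_pos.1 (by omega)
  -- A derivative of `x` is smaller than `q`, so its factors do not affect the multiplicity of `q`.
  have key : ∀ {u : Multiset M} {x x' : M} {a : A} (q : M), X.step x a x' → X.size x ≤ X.size q →
      (u.erase x + X.factors x').count q = (u.erase x).count q := by
    intro u x x' a q h hq
    rw [Multiset.count_add,
      Multiset.count_eq_zero_of_notMem (X.not_mem_factors (lt_of_lt_of_le (X.size_lt h) hq)),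
      add_zero]
  -- every element of `s` that is not larger than `p` is `p`
  have h1 : ∀ x ∈ s, X.size x ≤ X.size p → x = p := by
    intro x hx hle
    by_contra hne
    obtain ⟨a, x', hx'⟩ := X.exists_step (hs x hx).1
    obtain ⟨y, hy, y', hy', he⟩ := hst x hx a x' hx'
    rcases lt_or_ge (X.size p) (X.size y) with hlt' | hge
    · have hc := congrArg (Multiset.count y) he
      rw [key y hx' (by omega), key y hy' le_rfl, Multiset.count_erase_self,
        Multiset.count_erase_of_ne (by rintro rfl; omega), hp y hlt'] at hc
      have := Multiset.count_pos.2 hy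
      omega
    · have hc := congrArg (Multiset.count p) he
      rw [key p hx' hle, key p hy' hge, Multiset.count_erase_of_ne (Ne.symm hne)] at hc
      have := Multiset.count_le_of_le p (Multiset.erase_le y t)
      omega
  -- no element of `s` is larger than `p`
  have h2 : ∀ x ∈ s, ¬ X.size p < X.size x := by
    intro x₀ hx₀ hlt₀
    obtain ⟨a₀, x₀', hx₀'⟩ := X.exists_step (hs x₀ hx₀).1
    -- Among the transitions of elements larger than `p`, take one whose derivative has the most
    -- factors `p`. An answer by an element larger than `p` cannot make up for the copies of `p`
    -- that `t` lacks.
    let N : Set ℕ := {m | ∃ x ∈ s, X.size p < X.size x ∧ ∃ a x', X.step x a x' ∧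
      (X.factors x').count p = m}
    have hN : N.Nonempty := ⟨_, x₀, hx₀, hlt₀, a₀, x₀', hx₀', rfl⟩
    have hb : BddAbove N := by
      refine ⟨X.size s.sum, ?_⟩
      rintro m ⟨x, hx, -, a, x', hs', rfl⟩
      have e1 := X.size_lt hs'
      have e2 := X.size_le_of_mem hx
      have e3 : (X.factors x').count p * X.size p ≤ X.size x' := by
        have h3 : Multiset.replicate ((X.factors x').count p) p ≤ X.factors x' :=
          Multiset.le_count_iff_replicate_le.1 le_rfl
        obtain ⟨u, hu⟩ := Multiset.le_iff_exists_add.1 h3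
        have h4 := congrArg (fun v => X.size (Multiset.sum v)) hu
        simp only [X.sum_factors, Multiset.sum_add, Multiset.sum_replicate, map_add, map_nsmul,
          smul_eq_mul] at h4
        omega
      have e4 := X.size_pos (hs p hps).1
      nlinarith
    obtain ⟨x, hx, hxp, a, x', hx', hm⟩ := Nat.sSup_mem hN hb
    obtain ⟨y, hy, y', hy', he⟩ := hst x hx a x' hx'
    rcases lt_or_ge (X.size p) (X.size y) with hlt' | hge
    · have hys : y ∈ s := Multiset.count_pos.1 (by rw [hp y hlt']; exact Multiset.count_pos.2 hy)
      have hle : (X.factors y').count p ≤ sSup N := le_csSup hb ⟨y, hys, hlt', a, y', hy', rfl⟩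
      have hc := congrArg (Multiset.count p) he
      rw [Multiset.count_add, Multiset.count_add, Multiset.count_erase_of_ne (by rintro rfl; omega),
        Multiset.count_erase_of_ne (by rintro rfl; omega)] at hc
      omega
    · have hc := congrArg (Multiset.count x) he
      rw [key x hx' le_rfl, key x hy' (by omega), Multiset.count_erase_self,
        Multiset.count_erase_of_ne (by rintro rfl; omega), hp x hxp] at hc
      have := Multiset.count_pos.2 hx
      have := hp x hxp
      omega
  have h3 : s = Multiset.replicate (s.count p) p := by
    rw [Multiset.eq_replicate]
    have hall : ∀ x ∈ s, x = p := fun x hx => h1 x hx (not_lt.1 (h2 x hx))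
    exact ⟨(Multiset.count_eq_card.2 fun x hx => (hall x hx).symm).symm, hall⟩
  obtain ⟨a, p', hp'⟩ := X.exists_step (hs p hps).1
  -- A move of a copy of `p` in `t` can only be answered by `p`, the sole kind of element in `s`;
  -- both sides lose one copy, so the multiplicities would agree.
  have hpt : p ∉ t := by
    intro hpt
    obtain ⟨x, hx, x', hx', he⟩ := hts p hpt a p' hp'
    obtain rfl := h1 x hx (not_lt.1 (h2 x hx))
    have hc := congrArg (Multiset.count x) he
    rw [key x hx' le_rfl, key x hp' le_rfl, Multiset.count_erase_self,
      Multiset.count_erase_self] at hc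
    have := Multiset.count_pos.2 hpt
    omega
  have hsz : 0 < X.size s.sum := lt_of_lt_of_le (X.size_pos (hs p hps).1) (X.size_le_of_mem hps)
  obtain ⟨y, hy⟩ : ∃ y, y ∈ t := by
    apply Multiset.exists_mem_of_ne_zero
    rintro rfl
    rw [hsum] at hsz
    simp at hsz
  have hyp : X.size y ≤ X.size p := by
    by_contra! hlt'
    exact h2 y (Multiset.count_pos.1 (by rw [hp y hlt']; exact Multiset.count_pos.2 hy)) hlt'
  obtain ⟨b, y', hy'⟩ := X.exists_step (ht y hy).1
  obtain ⟨x, hx, x', hx', he⟩ := hts y hy b y' hy'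
  obtain rfl := h1 x hx (not_lt.1 (h2 x hx))
  have hc := congrArg (Multiset.count x) he
  have ht0 : t.count x = 0 := Multiset.count_eq_zero_of_notMem hpt
  rw [key x hx' le_rfl, key x hy' hyp, Multiset.count_erase_self,
    Multiset.count_erase_of_ne (by rintro rfl; exact hpt hy), ht0] at hc
  -- Answering a move of `y` costs `s` one copy of `p` and must leave none. So `p` alone is the sum
  -- of `t`, and indecomposability puts `p` in `t` after all.
  have hone : s.count x = 1 := by omega
  rw [hone, Multiset.replicate_one] at h3
  rw [h3, Multiset.sum_singleton, ← Multiset.cons_erase hy, Multiset.sum_cons] at hsum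
  rcases (hs x hps).2 _ _ hsum with h0 | h0
  · exact (ht y hy).1 h0
  · rw [h0, add_zero] at hsum
    exact hpt (hsum ▸ hy)

/-- Induction on the size of the sum: matching derivatives have equal sums of smaller size, hence
equal multisets of factors. This is the matching that `count_le_of_matching` requires. -/
theorem eq_of_sum_eq {s t : Multiset M} (hs : ∀ p ∈ s, Indecomposable p)
    (ht : ∀ p ∈ t, Indecomposable p) (h : s.sum = t.sum) : s = t := by
  classical
  induction hn : X.size s.sum using Nat.strong_induction_on generalizing s t with
  | _ n ih =>
    subst hn
    have half : ∀ {s' t' : Multiset M}, s'.sum = s.sum → (∀ p ∈ s', Indecomposable p) →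
        (∀ p ∈ t', Indecomposable p) → s'.sum = t'.sum → ∀ x ∈ s', ∀ a x', X.step x a x' →
        ∃ y ∈ t', ∃ y', X.step y a y' ∧
          s'.erase x + X.factors x' = t'.erase y + X.factors y' := by
      intro s' t' e hs' ht' h' x hx a x' hx'
      have hstep : X.step s'.sum a ((s'.erase x).sum + x') :=
        X.step_sum.2 ⟨x, hx, x', hx', rfl⟩
      have hlt := X.size_lt hstep
      rw [h'] at hstep
      obtain ⟨y, hy, y', hy', e'⟩ := X.step_sum.1 hstep
      refine ⟨y, hy, y', hy', ih _ (lt_of_lt_of_eq hlt (congrArg _ e)) ?_ ?_ ?_ ?_⟩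
      · intro p hp
        rcases Multiset.mem_add.1 hp with hp | hp
        exacts [hs' p (Multiset.mem_of_mem_erase hp), X.indecomposable_of_mem_factors hp]
      · intro p hp
        rcases Multiset.mem_add.1 hp with hp | hp
        exacts [ht' p (Multiset.mem_of_mem_erase hp), X.indecomposable_of_mem_factors hp]
      · simp only [Multiset.sum_add, X.sum_factors, e']
      · simp only [Multiset.sum_add, X.sum_factors]
    have hst := half rfl hs ht h
    have hts := half h.symm ht hs h.symm
    have hts' : ∀ y ∈ t, ∀ a y', X.step y a y' → ∃ x ∈ s, ∃ x', X.step x a x' ∧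
        s.erase x + X.factors x' = t.erase y + X.factors y' := fun y hy a y' h' => by
      obtain ⟨x, hx, x', hx', e⟩ := hts y hy a y' h'
      exact ⟨x, hx, x', hx', e.symm⟩
    have hst' : ∀ y ∈ s, ∀ a y', X.step y a y' → ∃ x ∈ t, ∃ x', X.step x a x' ∧
        t.erase x + X.factors x' = s.erase y + X.factors y' := fun y hy a y' h' => by
      obtain ⟨x, hx, x', hx', e⟩ := hst y hy a y' h'
      exact ⟨x, hx, x', hx', e.symm⟩
    -- Induction from large `p` to small `p`; for `k = 0`, `p` is too large to occur in either
    -- multiset.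
    have hbound : ∀ k p, X.size s.sum < X.size p + k → s.count p = t.count p := by
      intro k
      induction k with
      | zero =>
        intro p hp
        rw [Multiset.count_eq_zero_of_notMem, Multiset.count_eq_zero_of_notMem]
        · intro hm
          have := X.size_le_of_mem hm
          rw [← h] at this
          omega
        · intro hm
          have := X.size_le_of_mem hm
          omega
      | succ k ihk =>
        intro p hp
        have hq : ∀ q, X.size p < X.size q → s.count q = t.count q :=
          fun q hq => ihk q (by omega)
        exact le_antisymm (X.count_le_of_matching hs ht h hst hts' p hq)
          (X.count_le_of_matching ht hs h.symm hts hst' p fun q h' => (hq q h').symm)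
    exact Multiset.ext.2 fun p => hbound (X.size s.sum + 1) p (by omega)

theorem factors_sum {s : Multiset M} (hs : ∀ p ∈ s, Indecomposable p) : X.factors s.sum = s :=
  X.eq_of_sum_eq (fun _ => X.indecomposable_of_mem_factors) hs (X.sum_factors _)

theorem factors_add (x y : M) : X.factors (x + y) = X.factors x + X.factors y := by
  conv_lhs => rw [← X.sum_factors x, ← X.sum_factors y, ← Multiset.sum_add]
  refine X.factors_sum fun p hp => ?_
  rcases Multiset.mem_add.1 hp with hp | hp <;> exact X.indecomposable_of_mem_factors hp

theorem factors_zero : X.factors 0 = 0 := by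
  simpa using X.factors_sum (s := 0) (by simp)

theorem cancel {x y z : M} (h : x + z = y + z) : x = y := by
  have := congrArg X.factors h
  rw [X.factors_add, X.factors_add, add_left_inj] at this
  rw [← X.sum_factors x, this, X.sum_factors]

/-- An element with a single transition is a multiple of an indecomposable element with a single
transition. -/
theorem exists_nsmul_of_unique_step {x f : M} {a : A}
    (hx : ∀ b z, X.step x b z ↔ b = a ∧ z = f) :
    ∃ (k : ℕ) (p g : M), Indecomposable p ∧ (∀ b z, X.step p b z ↔ b = a ∧ z = g) ∧
      X.factors x = Multiset.replicate (k + 1) p ∧ f = g + k • p := by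
  classical
  have hx0 : x ≠ 0 := by
    rintro rfl
    exact X.not_step_zero ((hx a f).2 ⟨rfl, rfl⟩)
  obtain ⟨p, hp⟩ : ∃ p, p ∈ X.factors x := by
    apply Multiset.exists_mem_of_ne_zero
    intro h
    apply hx0
    rw [← X.sum_factors x, h, Multiset.sum_zero]
  have hpi := X.indecomposable_of_mem_factors hp
  have hstep : ∀ q ∈ X.factors x, ∀ b q', X.step q b q' →
      b = a ∧ ((X.factors x).erase q).sum + q' = f := by
    intro q hq b q' h
    rw [← hx]
    conv => arg 2; rw [← X.sum_factors x]
    exact X.step_sum.2 ⟨q, hq, q', h, rfl⟩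
  -- Moves of all factors lead to the same `f`. Of two distinct factors, moving the larger one
  -- destroys a copy of it, while moving the other does not.
  have hall : ∀ q ∈ X.factors x, q = p := by
    intro q hq
    by_contra hne
    obtain ⟨b, q', hq'⟩ := X.exists_step (X.indecomposable_of_mem_factors hq).1
    obtain ⟨c, p', hp'⟩ := X.exists_step hpi.1
    have e : ((X.factors x).erase q).sum + q' = ((X.factors x).erase p).sum + p' := by
      rw [(hstep q hq b q' hq').2, (hstep p hp c p' hp').2]
    have e' := congrArg X.factors e
    rw [X.factors_add, X.factors_add, X.factors_sum, X.factors_sum] at e'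
    · rcases le_total (X.size q) (X.size p) with hle | hle
      · have hc := congrArg (Multiset.count p) e'
        rw [Multiset.count_add, Multiset.count_add, Multiset.count_erase_self,
          Multiset.count_erase_of_ne (Ne.symm hne),
          Multiset.count_eq_zero_of_notMem (X.not_mem_factors (X.size_lt hp'))] at hc
        have := Multiset.count_pos.2 hp
        omega
      · have hc := congrArg (Multiset.count q) e'
        rw [Multiset.count_add, Multiset.count_add, Multiset.count_erase_self,
          Multiset.count_erase_of_ne hne,
          Multiset.count_eq_zero_of_notMem (X.not_mem_factors (X.size_lt hq'))] at hc
        have := Multiset.count_pos.2 hq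
        omega
    · exact fun r hr => X.indecomposable_of_mem_factors (Multiset.mem_of_mem_erase hr)
    · exact fun r hr => X.indecomposable_of_mem_factors (Multiset.mem_of_mem_erase hr)
  obtain ⟨b, g, hg⟩ := X.exists_step hpi.1
  obtain ⟨rfl, hgf⟩ := hstep p hp b g hg
  obtain ⟨k, hk⟩ : ∃ k, Multiset.card (X.factors x) = k + 1 :=
    ⟨_, (Nat.succ_pred_eq_of_pos (Multiset.card_pos_iff_exists_mem.2 ⟨p, hp⟩)).symm⟩
  have hrep : X.factors x = Multiset.replicate (k + 1) p := Multiset.eq_replicate.2 ⟨hk, hall⟩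
  refine ⟨k, p, g, hpi, fun c z => ⟨fun h => ?_, ?_⟩, hrep, ?_⟩
  · obtain ⟨rfl, hz⟩ := hstep p hp c z h
    refine ⟨rfl, X.cancel (z := ((X.factors x).erase p).sum) ?_⟩
    rw [add_comm, hz, add_comm, hgf]
  · rintro ⟨rfl, rfl⟩
    exact hg
  · rw [← hgf, hrep, Multiset.replicate_succ, Multiset.erase_cons_head, Multiset.sum_replicate,
      add_comm]

end ParallelLTS
end CCS

/-! ### Finite processes modulo bisimilarity. -/

namespace CCS

/-- The transitions of finite processes. -/
inductive FStep {A : Type*} : FProc A → A → FProc A → Prop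
  | pre (a : A) (F : FProc A) : FStep (.pre a F) a F
  | parL {a : A} {F F' : FProc A} (G : FProc A) : FStep F a F' → FStep (.par F G) a (.par F' G)
  | parR {a : A} {G G' : FProc A} (F : FProc A) : FStep G a G' → FStep (.par F G) a (.par F G')

section FiniteProcesses

variable {A : Type*}

theorem FStep.pre_iff {a b : A} {F G : FProc A} : FStep (.pre a F) b G ↔ b = a ∧ G = F := by
  constructor
  · rintro ⟨⟩
    exact ⟨rfl, rfl⟩
  · rintro ⟨rfl, rfl⟩
    exact .pre _ _

theorem FStep.par_iff {a : A} {F G H : FProc A} : FStep (.par F G) a H ↔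
    (∃ F', FStep F a F' ∧ H = .par F' G) ∨ (∃ G', FStep G a G' ∧ H = .par F G') := by
  constructor
  · rintro (_ | ⟨_, h⟩ | ⟨_, h⟩)
    · exact Or.inl ⟨_, h, rfl⟩
    · exact Or.inr ⟨_, h, rfl⟩
  · rintro (⟨F', h, rfl⟩ | ⟨G', h, rfl⟩)
    · exact .parL _ h
    · exact .parR _ h

/-- The number of prefixes. -/
def FProc.size : FProc A → ℕ
  | .nil => 0
  | .pre _ F => F.size + 1
  | .par F G => F.size + G.size

theorem FStep.size {F F' : FProc A} {a : A} (h : FStep F a F') : F.size = F'.size + 1 := by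
  induction h with
  | pre => rfl
  | parL G h ih => simp only [FProc.size]; omega
  | parR F h ih => simp only [FProc.size]; omega

theorem FProc.exists_step {F : FProc A} (h : F.size ≠ 0) : ∃ a F', FStep F a F' := by
  induction F with
  | nil => exact absurd rfl h
  | pre a F => exact ⟨a, F, .pre a F⟩
  | par F G ihF ihG =>
    by_cases hF : F.size = 0
    · obtain ⟨a, G', hG⟩ := ihG (by simp only [FProc.size] at h; omega)
      exact ⟨a, _, .parR _ hG⟩
    · obtain ⟨a, F', hF⟩ := ihF hF
      exact ⟨a, _, .parL _ hF⟩

/-- Bisimilarity of finite processes. -/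
def FBis (F G : FProc A) : Prop :=
  ∃ R : FProc A → FProc A → Prop, (∀ F G, R F G →
    (∀ a F', FStep F a F' → ∃ G', FStep G a G' ∧ R F' G') ∧
    (∀ a G', FStep G a G' → ∃ F', FStep F a F' ∧ R F' G')) ∧ R F G

theorem FBis.refl (F : FProc A) : FBis F F :=
  ⟨Eq, by rintro F _ rfl; exact ⟨fun a F' h => ⟨F', h, rfl⟩, fun a F' h => ⟨F', h, rfl⟩⟩, rfl⟩

theorem FBis.symm {F G : FProc A} : FBis F G → FBis G F := fun ⟨R, hR, h⟩ =>
  ⟨fun F G => R G F, fun F G h => ⟨(hR G F h).2, (hR G F h).1⟩, h⟩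

theorem FBis.trans {F G H : FProc A} : FBis F G → FBis G H → FBis F H := by
  rintro ⟨R, hR, h⟩ ⟨S, hS, h'⟩
  refine ⟨fun F H => ∃ G, R F G ∧ S G H, ?_, G, h, h'⟩
  rintro F H ⟨G, h, h'⟩
  constructor
  · intro a F' hF
    obtain ⟨G', hG, hr⟩ := (hR _ _ h).1 a F' hF
    obtain ⟨H', hH, hs⟩ := (hS _ _ h').1 a G' hG
    exact ⟨H', hH, G', hr, hs⟩
  · intro a H' hH
    obtain ⟨G', hG, hs⟩ := (hS _ _ h').2 a H' hH
    obtain ⟨F', hF, hr⟩ := (hR _ _ h).2 a G' hG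
    exact ⟨F', hF, G', hr, hs⟩

theorem FBis.step {F G F' : FProc A} {a : A} : FBis F G → FStep F a F' →
    ∃ G', FStep G a G' ∧ FBis F' G' := fun ⟨R, hR, h⟩ hF => by
  obtain ⟨G', hG, h'⟩ := (hR _ _ h).1 a F' hF
  exact ⟨G', hG, R, hR, h'⟩

/-- Each transition removes exactly one prefix, so the size is the length of every maximal run. -/
theorem FBis.size {F G : FProc A} (h : FBis F G) : F.size = G.size := by
  induction hn : F.size generalizing F G with
  | zero =>
    by_contra hne
    obtain ⟨a, G', hG⟩ := G.exists_step (Ne.symm hne)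
    obtain ⟨F', hF, -⟩ := h.symm.step hG
    have := hF.size
    omega
  | succ n ih =>
    obtain ⟨a, F', hF⟩ := F.exists_step (by omega)
    obtain ⟨G', hG, h'⟩ := h.step hF
    have := ih h' (by have := hF.size; omega)
    rw [this, hG.size]

theorem FBis.of_steps {F G : FProc A}
    (h1 : ∀ a F', FStep F a F' → ∃ G', FStep G a G' ∧ FBis F' G')
    (h2 : ∀ a G', FStep G a G' → ∃ F', FStep F a F' ∧ FBis F' G') : FBis F G := by
  refine ⟨fun F' G' => (F' = F ∧ G' = G) ∨ FBis F' G', ?_, Or.inl ⟨rfl, rfl⟩⟩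
  rintro F' G' (⟨rfl, rfl⟩ | h)
  · exact ⟨fun a X h => (h1 a X h).imp fun _ h => ⟨h.1, Or.inr h.2⟩,
      fun a X h => (h2 a X h).imp fun _ h => ⟨h.1, Or.inr h.2⟩⟩
  · exact ⟨fun a X hX => (h.step hX).imp fun _ h => ⟨h.1, Or.inr h.2⟩,
      fun a X hX => (h.symm.step hX).imp fun _ h => ⟨h.1, Or.inr h.2.symm⟩⟩

theorem FBis.pre (a : A) {F G : FProc A} (h : FBis F G) : FBis (.pre a F) (.pre a G) := by
  apply FBis.of_steps
  · rintro b F' ⟨⟩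
    exact ⟨G, .pre a G, h⟩
  · rintro b F' ⟨⟩
    exact ⟨F, .pre a F, h⟩

theorem FBis.par {F F' G G' : FProc A} (h : FBis F F') (h' : FBis G G') :
    FBis (.par F G) (.par F' G') := by
  refine ⟨fun X Y => ∃ F F' G G', FBis F F' ∧ FBis G G' ∧ X = .par F G ∧ Y = .par F' G', ?_,
    F, F', G, G', h, h', rfl, rfl⟩
  rintro _ _ ⟨F, F', G, G', h, h', rfl, rfl⟩
  constructor
  · intro a X hX
    rcases FStep.par_iff.1 hX with ⟨F₁, hF, rfl⟩ | ⟨G₁, hG, rfl⟩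
    · obtain ⟨F₂, hF₂, h₂⟩ := h.step hF
      exact ⟨_, .parL _ hF₂, _, _, _, _, h₂, h', rfl, rfl⟩
    · obtain ⟨G₂, hG₂, h₂⟩ := h'.step hG
      exact ⟨_, .parR _ hG₂, _, _, _, _, h, h₂, rfl, rfl⟩
  · intro a X hX
    rcases FStep.par_iff.1 hX with ⟨F₁, hF, rfl⟩ | ⟨G₁, hG, rfl⟩
    · obtain ⟨F₂, hF₂, h₂⟩ := h.symm.step hF
      exact ⟨_, .parL _ hF₂, _, _, _, _, h₂.symm, h', rfl, rfl⟩
    · obtain ⟨G₂, hG₂, h₂⟩ := h'.symm.step hG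
      exact ⟨_, .parR _ hG₂, _, _, _, _, h, h₂.symm, rfl, rfl⟩

theorem FBis.par_nil (F : FProc A) : FBis (.par F .nil) F := by
  refine ⟨fun X Y => X = .par Y .nil, ?_, rfl⟩
  rintro _ F rfl
  constructor
  · intro a X hX
    rcases FStep.par_iff.1 hX with ⟨F₁, hF, rfl⟩ | ⟨G₁, hG, rfl⟩
    · exact ⟨_, hF, rfl⟩
    · cases hG
  · exact fun a X hX => ⟨_, .parL _ hX, rfl⟩

theorem FBis.par_comm (F G : FProc A) : FBis (.par F G) (.par G F) := by
  have half : ∀ (F G X : FProc A) (a : A), FStep (.par F G) a X →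
      ∃ F' G', X = .par F' G' ∧ FStep (.par G F) a (.par G' F') := by
    intro F G X a hX
    rcases FStep.par_iff.1 hX with ⟨F₁, hF, rfl⟩ | ⟨G₁, hG, rfl⟩
    · exact ⟨_, _, rfl, .parR _ hF⟩
    · exact ⟨_, _, rfl, .parL _ hG⟩
  refine ⟨fun X Y => ∃ F G, X = .par F G ∧ Y = .par G F, ?_, F, G, rfl, rfl⟩
  rintro _ _ ⟨F, G, rfl, rfl⟩
  constructor
  · intro a X hX
    obtain ⟨F', G', rfl, h⟩ := half _ _ _ _ hX
    exact ⟨_, h, _, _, rfl, rfl⟩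
  · intro a X hX
    obtain ⟨F', G', rfl, h⟩ := half _ _ _ _ hX
    exact ⟨_, h, _, _, rfl, rfl⟩

theorem FBis.par_assoc (F G H : FProc A) :
    FBis (.par (.par F G) H) (.par F (.par G H)) := by
  refine ⟨fun X Y => ∃ F G H, X = .par (.par F G) H ∧ Y = .par F (.par G H), ?_,
    F, G, H, rfl, rfl⟩
  rintro _ _ ⟨F, G, H, rfl, rfl⟩
  constructor
  · intro a X hX
    rcases FStep.par_iff.1 hX with ⟨F₁, hF, rfl⟩ | ⟨G₁, hG, rfl⟩
    · rcases FStep.par_iff.1 hF with ⟨F₂, hF', rfl⟩ | ⟨G₂, hG, rfl⟩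
      · exact ⟨_, .parL _ hF', _, _, _, rfl, rfl⟩
      · exact ⟨_, .parR _ (.parL _ hG), _, _, _, rfl, rfl⟩
    · exact ⟨_, .parR _ (.parR _ hG), _, _, _, rfl, rfl⟩
  · intro a X hX
    rcases FStep.par_iff.1 hX with ⟨F₁, hF, rfl⟩ | ⟨G₁, hG, rfl⟩
    · exact ⟨_, .parL _ (.parL _ hF), _, _, _, rfl, rfl⟩
    · rcases FStep.par_iff.1 hG with ⟨F₂, hF, rfl⟩ | ⟨G₂, hG', rfl⟩
      · exact ⟨_, .parL _ (.parR _ hF), _, _, _, rfl, rfl⟩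
      · exact ⟨_, .parR _ hG', _, _, _, rfl, rfl⟩

/-- Bisimilarity of finite processes, as a setoid. -/
instance FProc.setoid (A : Type*) : Setoid (FProc A) := ⟨FBis, FBis.refl, FBis.symm, FBis.trans⟩

/-- Finite processes modulo bisimilarity. -/
def FClass (A : Type*) : Type _ := Quotient (FProc.setoid A)

/-- The bisimilarity class of a finite process. -/
def FProc.cls (F : FProc A) : FClass A := Quotient.mk _ F

/-- A representative of a bisimilarity class. -/
noncomputable def FClass.out (x : FClass A) : FProc A := Quotient.out x

theorem FClass.cls_out (x : FClass A) : x.out.cls = x := Quotient.out_eq x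

theorem FProc.cls_eq {F G : FProc A} : F.cls = G.cls ↔ FBis F G := Quotient.eq

theorem FClass.exists_cls (x : FClass A) : ∃ F : FProc A, F.cls = x := ⟨x.out, x.cls_out⟩

namespace FClass

/-- Prefixing on bisimilarity classes. -/
def pre (a : A) : FClass A → FClass A := Quotient.map (FProc.pre a) fun _ _ h => FBis.pre a h

instance : Zero (FClass A) := ⟨FProc.nil.cls⟩

instance : Add (FClass A) := ⟨Quotient.map₂ FProc.par fun _ _ h _ _ h' => FBis.par h h'⟩

instance : AddCommMonoid (FClass A) where
  add_assoc x y z := by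
    induction x, y, z using Quotient.inductionOn₃ with
    | _ F G H => exact FProc.cls_eq.2 (FBis.par_assoc F G H)
  zero_add x := by
    induction x using Quotient.inductionOn with
    | _ F => exact FProc.cls_eq.2 ((FBis.par_comm _ _).trans (FBis.par_nil F))
  add_zero x := by
    induction x using Quotient.inductionOn with
    | _ F => exact FProc.cls_eq.2 (FBis.par_nil F)
  add_comm x y := by
    induction x, y using Quotient.inductionOn₂ with
    | _ F G => exact FProc.cls_eq.2 (FBis.par_comm F G)
  nsmul := nsmulRec

end FClass

theorem FProc.cls_nil : (FProc.nil : FProc A).cls = 0 := rfl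

theorem FProc.cls_par (F G : FProc A) : (FProc.par F G).cls = F.cls + G.cls := rfl

theorem FProc.cls_pre (a : A) (F : FProc A) : (FProc.pre a F).cls = FClass.pre a F.cls := rfl

theorem FProc.cls_parCopies (F G : FProc A) (k : ℕ) :
    (F.parCopies G k).cls = F.cls + k • G.cls := by
  induction k with
  | zero => simp [FProc.parCopies]
  | succ k ih => rw [FProc.parCopies, FProc.cls_par, ih, succ_nsmul, add_assoc]

namespace FClass

/-- The transitions of bisimilarity classes. -/
def Step (x : FClass A) (a : A) (y : FClass A) : Prop :=
  ∃ F F' : FProc A, F.cls = x ∧ F'.cls = y ∧ FStep F a F'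

theorem step_cls {F : FProc A} {a : A} {y : FClass A} :
    Step F.cls a y ↔ ∃ F', FStep F a F' ∧ F'.cls = y := by
  constructor
  · rintro ⟨G, G', hG, rfl, h⟩
    obtain ⟨F', hF, h'⟩ := (FProc.cls_eq.1 hG).step h
    exact ⟨F', hF, FProc.cls_eq.2 h'.symm⟩
  · rintro ⟨F', h, rfl⟩
    exact ⟨F, F', rfl, rfl, h⟩

theorem step_pre {a b : A} {x y : FClass A} : Step (pre a x) b y ↔ b = a ∧ y = x := by
  obtain ⟨F, rfl⟩ := x.exists_cls
  rw [← FProc.cls_pre, step_cls]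
  simp [FStep.pre_iff, and_assoc, eq_comm]

theorem step_add {x y z : FClass A} {a : A} : Step (x + y) a z ↔
    (∃ x', Step x a x' ∧ z = x' + y) ∨ (∃ y', Step y a y' ∧ z = x + y') := by
  obtain ⟨F, rfl⟩ := x.exists_cls
  obtain ⟨G, rfl⟩ := y.exists_cls
  rw [← FProc.cls_par]
  simp only [step_cls, FStep.par_iff]
  constructor
  · rintro ⟨_, ⟨F', h, rfl⟩ | ⟨G', h, rfl⟩, rfl⟩
    · exact Or.inl ⟨_, ⟨F', h, rfl⟩, rfl⟩
    · exact Or.inr ⟨_, ⟨G', h, rfl⟩, rfl⟩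
  · rintro (⟨_, ⟨F', h, rfl⟩, rfl⟩ | ⟨_, ⟨G', h, rfl⟩, rfl⟩)
    · exact ⟨_, Or.inl ⟨F', h, rfl⟩, rfl⟩
    · exact ⟨_, Or.inr ⟨G', h, rfl⟩, rfl⟩

theorem ext {x y : FClass A} (h : ∀ a z, Step x a z ↔ Step y a z) : x = y := by
  obtain ⟨F, rfl⟩ := x.exists_cls
  obtain ⟨G, rfl⟩ := y.exists_cls
  refine FProc.cls_eq.2 (FBis.of_steps (fun a F' hF => ?_) fun a G' hG => ?_)
  · obtain ⟨G', hG, e⟩ := step_cls.1 ((h a F'.cls).1 (step_cls.2 ⟨F', hF, rfl⟩))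
    exact ⟨G', hG, FProc.cls_eq.1 e.symm⟩
  · obtain ⟨F', hF, e⟩ := step_cls.1 ((h a G'.cls).2 (step_cls.2 ⟨G', hG, rfl⟩))
    exact ⟨F', hF, FProc.cls_eq.1 e⟩

/-- The number of prefixes of a bisimilarity class. -/
def size : FClass A →+ ℕ where
  toFun := Quotient.lift FProc.size fun _ _ h => FBis.size h
  map_zero' := rfl
  map_add' x y := by
    induction x, y using Quotient.inductionOn₂ with
    | _ F G => rfl

theorem size_cls (F : FProc A) : size F.cls = F.size := rfl

theorem size_step {x y : FClass A} {a : A} (h : Step x a y) : size x = size y + 1 := by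
  obtain ⟨F, F', rfl, rfl, h⟩ := h
  exact h.size

theorem exists_step {x : FClass A} (h : size x ≠ 0) : ∃ a y, Step x a y := by
  obtain ⟨F, rfl⟩ := x.exists_cls
  obtain ⟨a, F', hF⟩ := F.exists_step h
  exact ⟨a, _, step_cls.2 ⟨F', hF, rfl⟩⟩

theorem not_step_zero {a : A} {y : FClass A} : ¬ Step 0 a y := fun h => by
  have := size_step h
  simp at this

theorem eq_zero_of_size {x : FClass A} (h : size x = 0) : x = 0 :=
  ext fun a z => ⟨fun h' => by have := size_step h'; omega, fun h' => absurd h' not_step_zero⟩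

/-- The transition system of bisimilarity classes of finite processes. -/
def lts (A : Type*) : ParallelLTS (FClass A) A where
  step := Step
  size := size
  eq_zero_of_size := eq_zero_of_size
  size_lt h := by have := size_step h; omega
  step_add := step_add
  ext := ext

theorem pre_inj {a b : A} {x y : FClass A} : pre a x = pre b y ↔ a = b ∧ x = y := by
  constructor
  · intro h
    exact step_pre.1 (h ▸ step_pre.2 ⟨rfl, rfl⟩ : Step (pre b y) a x)
  · rintro ⟨rfl, rfl⟩
    rfl

theorem eq_pre_iff {x f : FClass A} {a : A} :
    x = pre a f ↔ ∀ b z, Step x b z ↔ b = a ∧ z = f := by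
  constructor
  · rintro rfl b z
    exact step_pre
  · exact fun h => ext fun b z => by rw [h, step_pre]

theorem nsmul_step {x y : FClass A} {a : A} {k : ℕ} :
    Step ((k + 1) • x) a y ↔ ∃ x', Step x a x' ∧ y = x' + k • x := by
  induction k generalizing y with
  | zero => simp
  | succ k ih =>
    rw [succ_nsmul, step_add]
    simp only [ih]
    constructor
    · rintro (⟨_, ⟨x', h, rfl⟩, rfl⟩ | ⟨x', h, rfl⟩)
      · exact ⟨x', h, by rw [succ_nsmul, add_assoc]⟩
      · exact ⟨x', h, add_comm _ _⟩
    · rintro ⟨x', h, rfl⟩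
      exact Or.inr ⟨x', h, add_comm _ _⟩

/-- Both sides have a single transition, with the same label and the same target. -/
theorem distr (a : A) (x : FClass A) (k : ℕ) :
    pre a (x + k • pre a x) = (k + 1) • pre a x := by
  refine ext fun b z => ?_
  rw [step_pre, nsmul_step]
  simp only [step_pre, and_assoc, exists_and_left, exists_eq_left]

/-- An element with a single transition is itself a prefix, so the indecomposable given by
`exists_nsmul_of_unique_step` has the form `pre a g`. -/
theorem factors_pre (a : A) (f : FClass A) : ∃ (k : ℕ) (g : FClass A),
    Indecomposable (pre a g) ∧ (lts A).factors (pre a f) = Multiset.replicate (k + 1) (pre a g) ∧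
      f = g + k • pre a g := by
  obtain ⟨k, p, g, hp, hs, hf, e⟩ :=
    (lts A).exists_nsmul_of_unique_step (x := pre a f) (f := f) (a := a) fun b z => step_pre
  obtain rfl : p = pre a g := eq_pre_iff.2 hs
  exact ⟨k, g, hp, hf, e⟩

end FClass

end FiniteProcesses
end CCS

/-! ### Axiomatisation of bisimilarity on finite processes. -/

namespace CCS

section FiniteAxiomatisation

variable {A : Type*}

/-- The parallel composition of a list of processes. -/
def parList : List (Proc A) → Proc A
  | [] => .nil
  | P :: l => .par P (parList l)

theorem EqD.nil_par (P : Proc A) : EqD (.par .nil P) P := (EqD.par_comm _ _).trans (EqD.par_nil P)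

theorem EqD.par_left_comm (P Q R : Proc A) : EqD (.par P (.par Q R)) (.par Q (.par P R)) :=
  (EqD.par_assoc _ _ _).symm.trans (((EqD.par_comm P Q).par (EqD.refl R)).trans (EqD.par_assoc _ _ _))

theorem EqD.par_par_comm (P Q R S : Proc A) :
    EqD (.par (.par P Q) (.par R S)) (.par (.par P R) (.par Q S)) :=
  (EqD.par_assoc _ _ _).trans
    (((EqD.refl P).par (EqD.par_left_comm Q R S)).trans (EqD.par_assoc _ _ _).symm)

theorem parList_perm {l l' : List (Proc A)} (h : l.Perm l') : EqD (parList l) (parList l') := by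
  induction h with
  | nil => exact .refl _
  | cons P _ ih => exact (EqD.refl P).par ih
  | swap P Q l => exact EqD.par_left_comm _ _ _
  | trans _ _ h h' => exact h.trans h'

theorem parList_append (l l' : List (Proc A)) :
    EqD (parList (l ++ l')) (.par (parList l) (parList l')) := by
  induction l with
  | nil => exact (EqD.nil_par _).symm
  | cons P l ih => exact ((EqD.refl P).par ih).trans (EqD.par_assoc _ _ _).symm

theorem parList_replicate (F : FProc A) (k : ℕ) :
    EqD (parList (List.replicate (k + 1) F.toProc)) (F.parCopies F k).toProc := by
  induction k with
  | zero => exact EqD.par_nil _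
  | succ k ih => exact ((EqD.refl _).par ih).trans (EqD.par_comm _ _)

open Classical in
/-- A prefix that represents an indecomposable bisimilarity class. -/
noncomputable def FClass.prefixOf (p : FClass A) : Proc A :=
  -- The value `.nil` is junk: the proof of `eqD_factored` meets only factors that are prefixes.
  if h : ∃ a x, p = FClass.pre a x then .pre h.choose h.choose_spec.choose.out else .nil

theorem FClass.prefixOf_pre (a : A) (x : FClass A) :
    (FClass.pre a x).prefixOf = .pre a x.out := by
  have h : ∃ b y, FClass.pre a x = FClass.pre b y := ⟨a, x, rfl⟩
  obtain ⟨e1, e2⟩ := FClass.pre_inj.1 h.choose_spec.choose_spec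
  rw [FClass.prefixOf, dif_pos h]
  exact congrArg₂ (fun b (y : FClass A) => Proc.pre b y.out) e1.symm e2.symm

/-- The parallel composition of representatives of the prime factors of a class. -/
noncomputable def FClass.factored (x : FClass A) : Proc A :=
  parList (((lts A).factors x).toList.map prefixOf)

theorem FClass.factored_add (x y : FClass A) :
    EqD (x + y).factored (.par x.factored y.factored) := by
  refine EqD.trans (parList_perm ?_) (parList_append _ _)
  rw [← List.map_append]
  apply List.Perm.map
  rw [← Multiset.coe_eq_coe, ← Multiset.coe_add, Multiset.coe_toList, Multiset.coe_toList,
    Multiset.coe_toList, (lts A).factors_add]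

/-- The outer induction on size supplies `small`: below the bound, bisimilar processes are ≡-equal.
It lets the body of a prefix be replaced by the bisimilar form `g | a.g | ⋯ | a.g`, to which the
distribution law applies. -/
theorem eqD_factored (n : ℕ) (F : FProc A) (hF : F.size ≤ n) : EqD F.toProc F.cls.factored := by
  induction n using Nat.strong_induction_on generalizing F with
  | _ n ih =>
    have small : ∀ {F G : FProc A}, F.size < n → F.cls = G.cls → EqD F.toProc G.toProc := by
      intro F G hF h
      have hG : G.size = F.size := by rw [← FClass.size_cls, ← h, FClass.size_cls]
      have h1 := ih F.size hF F le_rfl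
      have h2 := ih F.size hF G hG.le
      rw [h] at h1
      exact h1.trans h2.symm
    induction F with
    | nil =>
      rw [FProc.cls_nil, FClass.factored, (FClass.lts A).factors_zero, Multiset.toList_zero]
      exact .refl _
    | par F G ihF ihG =>
      simp only [FProc.size] at hF
      rw [FProc.cls_par]
      exact ((ihF (by omega)).par (ihG (by omega))).trans (FClass.factored_add _ _).symm
    | pre a F =>
      simp only [FProc.size] at hF
      obtain ⟨k, g, -, hfac, hf⟩ := FClass.factors_pre a F.cls
      have hl : ((FClass.lts A).factors (FClass.pre a F.cls)).toList =
          List.replicate (k + 1) (FClass.pre a g) := by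
        rw [List.eq_replicate_iff, Multiset.length_toList, hfac]
        exact ⟨Multiset.card_replicate _ _, fun b hb =>
          Multiset.eq_of_mem_replicate (Multiset.mem_toList.1 hb)⟩
      rw [FProc.cls_pre, FClass.factored, hl, List.map_replicate, FClass.prefixOf_pre]
      refine EqD.trans (EqD.pre a (G := g.out.parCopies (.pre a g.out) k) (small hF ?_)) ?_
      · rw [FProc.cls_parCopies, FProc.cls_pre, FClass.cls_out, hf]
      · exact (EqD.distr a _ k).trans (parList_replicate (.pre a g.out) k).symm

/-- The laws of an abelian monoid and the distribution law axiomatise bisimilarity of finite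
processes. -/
theorem eqD_of_cls_eq {F G : FProc A} (h : F.cls = G.cls) : EqD F.toProc G.toProc :=
  (eqD_factored _ F le_rfl).trans (h ▸ (eqD_factored _ G le_rfl).symm)

end FiniteAxiomatisation
end CCS

/-! ### Finite processes beside a set of replicated prefixes. -/

namespace CCS

section ReplicatedBisimilarity

variable {A : Type*}

/-- The transitions of the class `x` in parallel with the replicated prefixes in `S`. -/
def RStep (S : Finset (A × FClass A)) (x : FClass A) (a : A) (y : FClass A) : Prop :=
  x.Step a y ∨ ∃ f, (a, f) ∈ S ∧ y = x + f

/-- A move of a replicated prefix may be credited to either summand; hence this form and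
`RStep.add_iff'`. -/
theorem RStep.add_iff {S : Finset (A × FClass A)} {x y w : FClass A} {a : A} :
    RStep S (x + y) a w ↔
      (∃ x', RStep S x a x' ∧ w = x' + y) ∨ (∃ y', y.Step a y' ∧ w = x + y') := by
  simp only [RStep, FClass.step_add]
  constructor
  · rintro ((⟨x', h, rfl⟩ | h) | ⟨f, hf, rfl⟩)
    · exact Or.inl ⟨x', Or.inl h, rfl⟩
    · exact Or.inr h
    · exact Or.inl ⟨_, Or.inr ⟨f, hf, rfl⟩, by abel⟩
  · rintro (⟨_, h | ⟨f, hf, rfl⟩, rfl⟩ | h)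
    · exact Or.inl (Or.inl ⟨_, h, rfl⟩)
    · exact Or.inr ⟨f, hf, by abel⟩
    · exact Or.inl (Or.inr h)

theorem RStep.add_iff' {S : Finset (A × FClass A)} {x y w : FClass A} {a : A} :
    RStep S (x + y) a w ↔
      (∃ x', x.Step a x' ∧ w = x' + y) ∨ (∃ y', RStep S y a y' ∧ w = x + y') := by
  rw [add_comm, RStep.add_iff, or_comm]
  simp only [add_comm]

theorem RStep.zero_iff {S : Finset (A × FClass A)} {w : FClass A} {a : A} :
    RStep S 0 a w ↔ (a, w) ∈ S := by
  simp [RStep, FClass.not_step_zero]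

/-- Bisimilarity of `x` in parallel with the replicated prefixes in `S`, and `y` in parallel with
those in `T`. -/
def RBis (S T : Finset (A × FClass A)) (x y : FClass A) : Prop :=
  ∃ R : FClass A → FClass A → Prop, (∀ x y, R x y →
    (∀ a x', RStep S x a x' → ∃ y', RStep T y a y' ∧ R x' y') ∧
    (∀ a y', RStep T y a y' → ∃ x', RStep S x a x' ∧ R x' y')) ∧ R x y

namespace RBis

variable {S T U : Finset (A × FClass A)} {x y z w : FClass A} {a : A}

theorem refl (S : Finset (A × FClass A)) (x : FClass A) : RBis S S x x :=
  ⟨Eq, by rintro F _ rfl; exact ⟨fun a F' h => ⟨F', h, rfl⟩, fun a F' h => ⟨F', h, rfl⟩⟩, rfl⟩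

theorem symm : RBis S T x y → RBis T S y x := fun ⟨R, hR, h⟩ =>
  ⟨fun F G => R G F, fun F G h => ⟨(hR G F h).2, (hR G F h).1⟩, h⟩

theorem trans : RBis S T x y → RBis T U y z → RBis S U x z := by
  rintro ⟨R, hR, h⟩ ⟨R', hR', h'⟩
  refine ⟨fun x z => ∃ y, R x y ∧ R' y z, ?_, y, h, h'⟩
  rintro F H ⟨G, h, h'⟩
  constructor
  · intro a F' hF
    obtain ⟨G', hG, hr⟩ := (hR _ _ h).1 a F' hF
    obtain ⟨H', hH, hs⟩ := (hR' _ _ h').1 a G' hG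
    exact ⟨H', hH, G', hr, hs⟩
  · intro a H' hH
    obtain ⟨G', hG, hs⟩ := (hR' _ _ h').2 a H' hH
    obtain ⟨F', hF, hr⟩ := (hR _ _ h).2 a G' hG
    exact ⟨F', hF, G', hr, hs⟩

theorem step {x' : FClass A} : RBis S T x y → RStep S x a x' →
    ∃ y', RStep T y a y' ∧ RBis S T x' y' := fun ⟨R, hR, h⟩ hx => by
  obtain ⟨y', hy, h'⟩ := (hR _ _ h).1 a x' hx
  exact ⟨y', hy, R, hR, h'⟩

theorem step' {y' : FClass A} (h : RBis S T x y) (hy : RStep T y a y') :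
    ∃ x', RStep S x a x' ∧ RBis S T x' y' :=
  (h.symm.step hy).imp fun _ h => ⟨h.1, h.2.symm⟩

/-- Bisimulation up to bisimilarity of the left-hand side. -/
theorem of_upTo (R : FClass A → FClass A → Prop)
    (h1 : ∀ x y, R x y → ∀ a x', RStep S x a x' →
      ∃ y', RStep T y a y' ∧ ∃ z, RBis S S x' z ∧ R z y')
    (h2 : ∀ x y, R x y → ∀ a y', RStep T y a y' →
      ∃ x', RStep S x a x' ∧ ∃ z, RBis S S x' z ∧ R z y')
    (h : R x y) : RBis S T x y := by
  refine ⟨fun x y => ∃ z, RBis S S x z ∧ R z y, ?_, x, refl S x, h⟩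
  rintro x y ⟨z, hxz, hzy⟩
  constructor
  · intro a x' hx
    obtain ⟨z', hz, hxz'⟩ := hxz.step hx
    obtain ⟨y', hy, w, hw, hwy⟩ := h1 z y hzy a z' hz
    exact ⟨y', hy, w, hxz'.trans hw, hwy⟩
  · intro a y' hy
    obtain ⟨z', hz, w, hw, hwy⟩ := h2 z y hzy a y' hy
    obtain ⟨x', hx, hxz'⟩ := hxz.step' hz
    exact ⟨x', hx, w, hxz'.trans hw, hwy⟩

theorem add_right (h : RBis S T x y) (z : FClass A) : RBis S T (x + z) (y + z) := by
  refine ⟨fun u v => ∃ x y z, RBis S T x y ∧ u = x + z ∧ v = y + z, ?_, x, y, z, h, rfl, rfl⟩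
  rintro _ _ ⟨x, y, z, h, rfl, rfl⟩
  constructor
  · intro a w hw
    rcases RStep.add_iff.1 hw with ⟨x', hx, rfl⟩ | ⟨z', hz, rfl⟩
    · obtain ⟨y', hy, h'⟩ := h.step hx
      exact ⟨_, RStep.add_iff.2 (Or.inl ⟨y', hy, rfl⟩), _, _, _, h', rfl, rfl⟩
    · exact ⟨_, RStep.add_iff.2 (Or.inr ⟨z', hz, rfl⟩), _, _, _, h, rfl, rfl⟩
  · intro a w hw
    rcases RStep.add_iff.1 hw with ⟨y', hy, rfl⟩ | ⟨z', hz, rfl⟩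
    · obtain ⟨x', hx, h'⟩ := h.step' hy
      exact ⟨_, RStep.add_iff.2 (Or.inl ⟨x', hx, rfl⟩), _, _, _, h', rfl, rfl⟩
    · exact ⟨_, RStep.add_iff.2 (Or.inr ⟨z', hz, rfl⟩), _, _, _, h, rfl, rfl⟩

theorem add (h : RBis S S x y) (h' : RBis S S z w) : RBis S S (x + z) (y + w) := by
  refine (h.add_right z).trans ?_
  rw [add_comm y z, add_comm y w]
  exact h'.add_right y

theorem add_left (h : RBis S S x y) (z : FClass A) : RBis S S (z + x) (z + y) := (refl S z).add h

/-- The absorbed elements are closed under taking summands. -/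
theorem left_of_add (h : RBis S S (x + y) 0) : RBis S S x 0 := by
  refine of_upTo (fun u v => u = x + v) ?_ ?_ (add_zero x).symm
  · rintro _ z rfl a w hw
    rcases RStep.add_iff'.1 hw with ⟨x', hx, rfl⟩ | ⟨z', hz, rfl⟩
    · obtain ⟨f, hf, hf'⟩ := h.step (RStep.add_iff.2 (Or.inl ⟨x', Or.inl hx, rfl⟩))
      rw [RStep.zero_iff] at hf
      refine ⟨z + f, Or.inr ⟨f, hf, rfl⟩, _, ?_, rfl⟩
      -- Adding the absorbed `x + y` to `x'` and regrouping gives `x' ∼ x' + (x + y) = (x' + y) + x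
      -- ∼ f + x`, which closes the up-to relation.
      have h1 : RBis S S (x' + (x + y)) (x' + 0) := h.add_left x'
      have h2 : RBis S S (x' + y + x) (f + x) := hf'.add_right x
      rw [show x' + (x + y) = x' + y + x by abel, add_zero] at h1
      have h3 := (h1.symm.trans h2).add_right z
      rwa [show f + x + z = x + (z + f) by abel] at h3
    · exact ⟨z', hz, _, refl _ _, rfl⟩
  · rintro _ z rfl a w hw
    exact ⟨x + w, RStep.add_iff'.2 (Or.inr ⟨w, hw, rfl⟩), _, refl _ _, rfl⟩

/-- Let `x` use up all its prefixes, while the other side follows. -/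
theorem exists_zero_left (h : RBis S T x y) : ∃ w, RBis S T 0 w := by
  induction hn : FClass.size x generalizing x y with
  | zero => exact ⟨y, FClass.eq_zero_of_size hn ▸ h⟩
  | succ n ih =>
    obtain ⟨a, x', hx⟩ := FClass.exists_step (x := x) (by omega)
    obtain ⟨y', -, h'⟩ := h.step (Or.inl hx)
    exact ih h' (by have := FClass.size_step hx; omega)

/-- If two processes are bisimilar, then so are their replicated parts. -/
theorem zero_zero (h : RBis S T x y) : RBis S T 0 0 := by
  obtain ⟨g, hg⟩ := h.exists_zero_left
  obtain ⟨f, hf⟩ := h.symm.exists_zero_left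
  replace hf := hf.symm
  -- From `f ∼ 0` and `0 ∼ g` across `S` and `T` it follows that `f + g ∼ g ∼ 0`, now with `S` at
  -- both ends. So `S` absorbs `f + g`, hence `f`.
  have h1 := hf.add_right g
  rw [zero_add] at h1
  exact (h1.trans hg.symm).left_of_add.symm.trans hf

theorem of_zero_zero (h : RBis S T 0 0) (x : FClass A) : RBis S T x x := by
  simpa using h.add_right x

/-- Only a replicated prefix can answer the move of `pre a x` from `0`. Conversely, spawning such an
`f` imitates that move, and `pre a x` can be ignored until then. -/
theorem pre_zero_iff : RBis S S (FClass.pre a x) 0 ↔ ∃ f, (a, f) ∈ S ∧ RBis S S x f := by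
  constructor
  · intro h
    obtain ⟨f, hf, hf'⟩ := h.step (Or.inl (FClass.step_pre.2 ⟨rfl, rfl⟩))
    exact ⟨f, RStep.zero_iff.1 hf, hf'⟩
  · rintro ⟨f, hf, h⟩
    refine of_upTo (fun u v => u = FClass.pre a x + v ∨ u = v) ?_ ?_ (Or.inl (add_zero _).symm)
    · rintro _ z (rfl | rfl) b w hw
      · rcases RStep.add_iff'.1 hw with ⟨x', hx, rfl⟩ | ⟨z', hz, rfl⟩
        · obtain ⟨rfl, rfl⟩ := FClass.step_pre.1 hx
          refine ⟨z + f, Or.inr ⟨f, hf, rfl⟩, _, ?_, Or.inr rfl⟩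
          rw [add_comm z f]
          exact h.add_right z
        · exact ⟨z', hz, _, refl _ _, Or.inl rfl⟩
      · exact ⟨w, hw, w, refl _ _, Or.inr rfl⟩
    · rintro _ z (rfl | rfl) b w hw
      · exact ⟨_, RStep.add_iff'.2 (Or.inr ⟨w, hw, rfl⟩), _, refl _ _, Or.inl rfl⟩
      · exact ⟨w, hw, w, refl _ _, Or.inr rfl⟩

theorem pre (a : A) (h : RBis S S x y) : RBis S S (FClass.pre a x) (FClass.pre a y) := by
  refine of_upTo (fun u v => (∃ z, u = FClass.pre a x + z ∧ v = FClass.pre a y + z) ∨ u = v)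
    ?_ ?_ (Or.inl ⟨0, (add_zero _).symm, (add_zero _).symm⟩)
  · rintro u v (⟨z, rfl, rfl⟩ | rfl) b w hw
    · rcases RStep.add_iff'.1 hw with ⟨x', hx, rfl⟩ | ⟨z', hz, rfl⟩
      · obtain ⟨rfl, rfl⟩ := FClass.step_pre.1 hx
        exact ⟨y + z, RStep.add_iff'.2 (Or.inl ⟨y, FClass.step_pre.2 ⟨rfl, rfl⟩, rfl⟩), _,
          h.add_right z, Or.inr rfl⟩
      · exact ⟨_, RStep.add_iff'.2 (Or.inr ⟨z', hz, rfl⟩), _, refl _ _, Or.inl ⟨_, rfl, rfl⟩⟩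
    · exact ⟨w, hw, w, refl _ _, Or.inr rfl⟩
  · rintro u v (⟨z, rfl, rfl⟩ | rfl) b w hw
    · rcases RStep.add_iff'.1 hw with ⟨x', hx, rfl⟩ | ⟨z', hz, rfl⟩
      · obtain ⟨rfl, rfl⟩ := FClass.step_pre.1 hx
        exact ⟨x + z, RStep.add_iff'.2 (Or.inl ⟨x, FClass.step_pre.2 ⟨rfl, rfl⟩, rfl⟩), _,
          h.add_right z, Or.inr rfl⟩
      · exact ⟨_, RStep.add_iff'.2 (Or.inr ⟨z', hz, rfl⟩), _, refl _ _, Or.inl ⟨_, rfl, rfl⟩⟩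
    · exact ⟨w, hw, w, refl _ _, Or.inr rfl⟩

end RBis

/-- Every replicated prefix in `U` has a counterpart in `V`, up to bisimilarity in parallel
with `S`. -/
def Covers (S U V : Finset (A × FClass A)) : Prop :=
  ∀ a f, (a, f) ∈ U → ∃ g, (a, g) ∈ V ∧ RBis S S f g

theorem Covers.refl (S U : Finset (A × FClass A)) : Covers S U U :=
  fun _ f h => ⟨f, h, RBis.refl _ _⟩

theorem Covers.trans {S U V W : Finset (A × FClass A)} (h : Covers S U V) (h' : Covers S V W) :
    Covers S U W := fun a f hf => by
  obtain ⟨g, hg, e⟩ := h a f hf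
  obtain ⟨k, hk, e'⟩ := h' a g hg
  exact ⟨k, hk, e.trans e'⟩

theorem RBis.covers {S T : Finset (A × FClass A)} (h : RBis S T 0 0) :
    Covers S S T ∧ Covers S T S := by
  constructor
  · intro a f hf
    obtain ⟨g, hg, e⟩ := h.step (RStep.zero_iff.2 hf)
    exact ⟨g, RStep.zero_iff.1 hg, e.trans (h.of_zero_zero g).symm⟩
  · intro a f hf
    obtain ⟨g, hg, e⟩ := h.step' (RStep.zero_iff.2 hf)
    exact ⟨g, RStep.zero_iff.1 hg, (h.of_zero_zero f).trans e.symm⟩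

/-- The relation `RBis S S` is itself a bisimulation between the two sides: a spawned body is
exchanged for its counterpart. -/
theorem Covers.rBis {S T : Finset (A × FClass A)} (h : Covers S S T) (h' : Covers S T S) :
    RBis S T 0 0 := by
  refine ⟨fun x y => RBis S S x y, ?_, RBis.refl _ _⟩
  intro x y hxy
  constructor
  · intro a x' hx
    obtain ⟨y', hy | ⟨f, hf, rfl⟩, e⟩ := hxy.step hx
    · exact ⟨y', Or.inl hy, e⟩
    · obtain ⟨g, hg, e'⟩ := h a f hf
      exact ⟨_, Or.inr ⟨g, hg, rfl⟩, e.trans (e'.add_left y)⟩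
  · rintro a y' (hy | ⟨f, hf, rfl⟩)
    · exact hxy.step' (Or.inl hy)
    · obtain ⟨g, hg, e'⟩ := h' a f hf
      obtain ⟨x', hx, e⟩ := hxy.step' (Or.inr ⟨g, hg, rfl⟩)
      exact ⟨x', hx, e.trans (e'.symm.add_left y)⟩

/-- `F` has no subterm `α.G` that is absorbed by the replicated prefixes in `S`. -/
def Reduced (S : Finset (A × FClass A)) : FProc A → Prop
  | .nil => True
  | .pre a F => ¬ RBis S S (FClass.pre a F.cls) 0 ∧ Reduced S F
  | .par F G => Reduced S F ∧ Reduced S G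

theorem Reduced.step {S : Finset (A × FClass A)} {F F' : FProc A} {a : A} (h : FStep F a F')
    (hF : Reduced S F) : Reduced S F' := by
  induction h with
  | pre => exact hF.2
  | parL G _ ih => exact ⟨ih hF.1, hF.2⟩
  | parR F _ ih => exact ⟨hF.1, ih hF.2⟩

theorem Reduced.eq_zero {S : Finset (A × FClass A)} {F : FProc A} (hF : Reduced S F)
    (h : RBis S S F.cls 0) : F.cls = 0 := by
  induction F with
  | nil => rfl
  | pre a F => exact absurd h hF.1
  | par F G ihF ihG =>
    rw [FProc.cls_par] at h ⊢
    have h' := h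
    rw [add_comm] at h'
    rw [ihF hF.1 h.left_of_add, ihG hF.2 h'.left_of_add, add_zero]

/-- Run `y` down to `0`. Each move is followed by at most one prefix of `F`, and what is left of `F`
at the end is absorbed, hence empty because `F` is reduced. -/
theorem Reduced.size_le {S : Finset (A × FClass A)} {F : FProc A} (hF : Reduced S F)
    {y w : FClass A} (h : RBis S S (F.cls + w) y) : F.size ≤ FClass.size y := by
  induction hn : FClass.size y generalizing F y w with
  | zero =>
    obtain rfl := FClass.eq_zero_of_size hn
    have := hF.eq_zero h.left_of_add
    rw [← FClass.size_cls, this, map_zero]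
  | succ n ih =>
    obtain ⟨a, y', hy⟩ := FClass.exists_step (x := y) (by omega)
    have hsz := FClass.size_step hy
    obtain ⟨x', hx, e⟩ := h.step' (Or.inl hy)
    rcases RStep.add_iff'.1 hx with ⟨z, hz, rfl⟩ | ⟨z, -, rfl⟩
    · obtain ⟨F', hF', rfl⟩ := FClass.step_cls.1 hz
      have := ih (hF.step hF') e (by omega)
      rw [hF'.size]
      omega
    · have := ih hF e (by omega)
      omega

/-- Reduced finite processes that are bisimilar in parallel with `S` are bisimilar. -/
theorem Reduced.cls_eq {S : Finset (A × FClass A)} {F G : FProc A} (hF : Reduced S F)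
    (hG : Reduced S G) (h : RBis S S F.cls G.cls) : F.cls = G.cls := by
  have half : ∀ {F G F' : FProc A} {a : A}, Reduced S F → Reduced S G → RBis S S F.cls G.cls →
      FStep F a F' → ∃ G', FStep G a G' ∧ RBis S S F'.cls G'.cls := by
    intro F G F' a hF hG h hF'
    obtain ⟨y, hy | ⟨f, -, rfl⟩, e⟩ := h.step (Or.inl (FClass.step_cls.2 ⟨F', hF', rfl⟩))
    · obtain ⟨G', hG', rfl⟩ := FClass.step_cls.1 hy
      exact ⟨G', hG', e⟩
    -- An answer by a replicated prefix would leave all of `G` in place beside the smaller `F'`, so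
    -- `G.size ≤ F'.size < F.size ≤ G.size`.
    · have h1 := hG.size_le e.symm
      have h2 := hF.size_le (w := 0) (by rwa [add_zero])
      have h3 := hF'.size
      rw [FClass.size_cls] at h1 h2
      omega
  refine FProc.cls_eq.2 ⟨fun F G => Reduced S F ∧ Reduced S G ∧ RBis S S F.cls G.cls, ?_,
    hF, hG, h⟩
  rintro F G ⟨hF, hG, h⟩
  constructor
  · intro a F' hF'
    obtain ⟨G', hG', e⟩ := half hF hG h hF'
    exact ⟨G', hG', hF.step hF', hG.step hG', e⟩
  · intro a G' hG'
    obtain ⟨F', hF', e⟩ := half hG hF h.symm hG'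
    exact ⟨F', hF', hF.step hF', hG.step hG', e.symm⟩

open Classical in
/-- Erase all subterms `α.G` that are absorbed by the replicated prefixes in `S`. -/
noncomputable def FProc.reduce (S : Finset (A × FClass A)) : FProc A → FProc A
  | .nil => .nil
  | .pre a F => if RBis S S (FClass.pre a F.cls) 0 then .nil else .pre a (F.reduce S)
  | .par F G => .par (F.reduce S) (G.reduce S)

theorem FProc.rBis_reduce (S : Finset (A × FClass A)) (F : FProc A) :
    RBis S S F.cls (F.reduce S).cls := by
  induction F with
  | nil => exact RBis.refl _ _
  | pre a F ih =>
    rw [FProc.reduce]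
    split_ifs with h
    · exact h
    · exact RBis.pre a ih
  | par F G ihF ihG => exact ihF.add ihG

theorem FProc.reduced_reduce (S : Finset (A × FClass A)) (F : FProc A) :
    Reduced S (F.reduce S) := by
  induction F with
  | nil => trivial
  | pre a F ih =>
    rw [FProc.reduce]
    split_ifs with h
    · trivial
    -- `reduce` tests the original body; congruence carries the test over to the reduced one.
    · exact ⟨fun h' => h ((RBis.pre a (F.rBis_reduce S)).trans h'), ih⟩
  | par F G ihF ihG => exact ⟨ihF, ihG⟩

end ReplicatedBisimilarity
end CCS

/-! ### Soundness: convertible processes are bisimilar. -/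

namespace CCS

section Soundness

variable {A : Type*}

noncomputable instance : DecidableEq (A × FClass A) := Classical.decEq _

/-- The replicated prefixes of a process, modulo bisimilarity. -/
noncomputable def Proc.reps : Proc A → Finset (A × FClass A)
  | .nil => ∅
  | .pre _ _ => ∅
  | .rep a F => {(a, F.cls)}
  | .par P Q => P.reps ∪ Q.reps

/-- The finite part of a process, modulo bisimilarity. -/
def Proc.fin : Proc A → FClass A
  | .nil => 0
  | .pre a F => FClass.pre a F.cls
  | .rep _ _ => 0
  | .par P Q => P.fin + Q.fin

theorem FProc.reps_toProc (F : FProc A) : F.toProc.reps = ∅ := by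
  induction F with
  | nil => rfl
  | pre => rfl
  | par F G ihF ihG => rw [FProc.toProc, Proc.reps, ihF, ihG, Finset.empty_union]

theorem FProc.fin_toProc (F : FProc A) : F.toProc.fin = F.cls := by
  induction F with
  | nil => rfl
  | pre => rfl
  | par F G ihF ihG => rw [FProc.toProc, Proc.fin, ihF, ihG, FProc.cls_par]

theorem Proc.mem_reps_par {P Q : Proc A} {p : A × FClass A} :
    p ∈ (Proc.par P Q).reps ↔ p ∈ P.reps ∨ p ∈ Q.reps := by
  rw [Proc.reps, Finset.mem_union]

theorem Step.reps {P P' : Proc A} {a : A} (h : Step P a P') : P'.reps = P.reps := by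
  induction h with
  | pre a F => exact F.reps_toProc
  | rep a F => simp only [Proc.reps, FProc.reps_toProc, Finset.union_empty]
  | parL Q _ ih => rw [Proc.reps, Proc.reps, ih]
  | parR P _ ih => rw [Proc.reps, Proc.reps, ih]

theorem Step.fin {P P' : Proc A} {a : A} (h : Step P a P') : RStep P.reps P.fin a P'.fin := by
  induction h with
  | pre a F => exact Or.inl (FClass.step_pre.2 ⟨rfl, F.fin_toProc⟩)
  | rep a F =>
    exact Or.inr ⟨F.cls, Finset.mem_singleton_self _, by simp only [Proc.fin, FProc.fin_toProc]⟩
  | parL Q _ ih =>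
    rcases ih with h | ⟨f, hf, e⟩
    · exact Or.inl (FClass.step_add.2 (Or.inl ⟨_, h, rfl⟩))
    · exact Or.inr ⟨f, Proc.mem_reps_par.2 (Or.inl hf), by
        rw [Proc.fin, Proc.fin, e]; abel⟩
  | parR P _ ih =>
    rcases ih with h | ⟨f, hf, e⟩
    · exact Or.inl (FClass.step_add.2 (Or.inr ⟨_, h, rfl⟩))
    · exact Or.inr ⟨f, Proc.mem_reps_par.2 (Or.inr hf), by
        rw [Proc.fin, Proc.fin, e]; abel⟩

theorem Proc.exists_step {P : Proc A} {a : A} {w : FClass A} (h : RStep P.reps P.fin a w) :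
    ∃ P', Step P a P' ∧ P'.fin = w := by
  induction P generalizing w with
  | nil =>
    rcases h with h | ⟨f, hf, -⟩
    · exact absurd h FClass.not_step_zero
    · exact absurd hf (Finset.notMem_empty _)
  | pre b F =>
    rcases h with h | ⟨f, hf, -⟩
    · obtain ⟨rfl, rfl⟩ := FClass.step_pre.1 h
      exact ⟨_, .pre _ F, F.fin_toProc⟩
    · exact absurd hf (Finset.notMem_empty _)
  | rep b F =>
    rcases h with h | ⟨f, hf, rfl⟩
    · exact absurd h FClass.not_step_zero
    · obtain ⟨rfl, rfl⟩ := Prod.mk.inj (Finset.mem_singleton.1 hf)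
      exact ⟨_, .rep _ F, by simp only [Proc.fin, FProc.fin_toProc]⟩
  | par P Q ihP ihQ =>
    rcases h with h | ⟨f, hf, rfl⟩
    · rcases FClass.step_add.1 h with ⟨x', hx, rfl⟩ | ⟨y', hy, rfl⟩
      · obtain ⟨P', hP, rfl⟩ := ihP (Or.inl hx)
        exact ⟨_, .parL Q hP, rfl⟩
      · obtain ⟨Q', hQ, rfl⟩ := ihQ (Or.inl hy)
        exact ⟨_, .parR P hQ, rfl⟩
    · rcases Proc.mem_reps_par.1 hf with hf | hf
      · obtain ⟨P', hP, e⟩ := ihP (Or.inr ⟨f, hf, rfl⟩)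
        exact ⟨_, .parL Q hP, by rw [Proc.fin, Proc.fin, e]; abel⟩
      · obtain ⟨Q', hQ, e⟩ := ihQ (Or.inr ⟨f, hf, rfl⟩)
        exact ⟨_, .parR P hQ, by rw [Proc.fin, Proc.fin, e]; abel⟩

/-- The replicated prefixes are constant along transitions, and the transitions of the finite part
are exactly those of `RStep`. -/
theorem bisimilar_iff {P Q : Proc A} : Bisimilar P Q ↔ RBis P.reps Q.reps P.fin Q.fin := by
  constructor
  · rintro ⟨R, hR, h⟩
    refine ⟨fun x y => ∃ P' Q', R P' Q' ∧ P'.reps = P.reps ∧ Q'.reps = Q.reps ∧ P'.fin = x ∧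
      Q'.fin = y, ?_, P, Q, h, rfl, rfl, rfl, rfl⟩
    rintro _ _ ⟨P', Q', h, hP, hQ, rfl, rfl⟩
    rw [← hP, ← hQ]
    constructor
    · intro a x hx
      obtain ⟨P₁, h₁, rfl⟩ := Proc.exists_step hx
      obtain ⟨Q₁, h₂, h'⟩ := (hR _ _ h).1 a P₁ h₁
      exact ⟨_, h₂.fin, P₁, Q₁, h', h₁.reps, h₂.reps, rfl, rfl⟩
    · intro a x hx
      obtain ⟨Q₁, h₁, rfl⟩ := Proc.exists_step hx
      obtain ⟨P₁, h₂, h'⟩ := (hR _ _ h).2 a Q₁ h₁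
      exact ⟨_, h₂.fin, P₁, Q₁, h', h₂.reps, h₁.reps, rfl, rfl⟩
  · intro h
    refine ⟨fun P Q => RBis P.reps Q.reps P.fin Q.fin, ?_, h⟩
    intro P Q h
    constructor
    · intro a P' hP
      obtain ⟨y, hy, e⟩ := h.step hP.fin
      obtain ⟨Q', hQ, rfl⟩ := Proc.exists_step hy
      exact ⟨Q', hQ, by beta_reduce; rwa [hP.reps, hQ.reps]⟩
    · intro a Q' hQ
      obtain ⟨y, hy, e⟩ := h.step' hQ.fin
      obtain ⟨P', hP, rfl⟩ := Proc.exists_step hy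
      exact ⟨P', hP, by beta_reduce; rwa [hP.reps, hQ.reps]⟩

theorem EqD.reps_fin {P Q : Proc A} (h : EqD P Q) : P.reps = Q.reps ∧ P.fin = Q.fin := by
  induction h with
  | refl => exact ⟨rfl, rfl⟩
  | symm _ ih => exact ⟨ih.1.symm, ih.2.symm⟩
  | trans _ _ ih ih' => exact ⟨ih.1.trans ih'.1, ih.2.trans ih'.2⟩
  | @pre a F G _ ih =>
    rw [F.fin_toProc, G.fin_toProc] at ih
    exact ⟨rfl, by rw [Proc.fin, Proc.fin, ih.2]⟩
  | @rep a F G _ ih =>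
    rw [F.fin_toProc, G.fin_toProc] at ih
    exact ⟨by rw [Proc.reps, Proc.reps, ih.2], rfl⟩
  | par _ _ ih ih' =>
    exact ⟨by rw [Proc.reps, Proc.reps, ih.1, ih'.1], by rw [Proc.fin, Proc.fin, ih.2, ih'.2]⟩
  | par_nil P => exact ⟨Finset.union_empty _, add_zero _⟩
  | par_comm P Q => exact ⟨Finset.union_comm _ _, add_comm _ _⟩
  | par_assoc P Q R => exact ⟨Finset.union_assoc _ _ _, add_assoc _ _ _⟩
  | distr a F k =>
    refine ⟨(FProc.reps_toProc _).symm, ?_⟩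
    rw [FProc.fin_toProc, FProc.cls_parCopies, Proc.fin, FProc.cls_parCopies, FProc.cls_pre,
      FClass.distr, succ_nsmul, add_comm]

/-- `P` and `Q` have the same replicated prefixes and the same finite part, up to bisimilarity in
parallel with the replicated prefixes in `S`. -/
def Similar (S : Finset (A × FClass A)) (P Q : Proc A) : Prop :=
  Covers S P.reps Q.reps ∧ Covers S Q.reps P.reps ∧ RBis S S P.fin Q.fin

namespace Similar

variable {S : Finset (A × FClass A)} {P Q R P' Q' : Proc A}

theorem of_eq (h : P.reps = Q.reps) (h' : P.fin = Q.fin) : Similar S P Q := by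
  refine ⟨?_, ?_, ?_⟩
  · rw [h]; exact Covers.refl _ _
  · rw [h]; exact Covers.refl _ _
  · rw [h']; exact RBis.refl _ _

theorem symm (h : Similar S P Q) : Similar S Q P := ⟨h.2.1, h.1, h.2.2.symm⟩

theorem trans (h : Similar S P Q) (h' : Similar S Q R) : Similar S P R :=
  ⟨h.1.trans h'.1, h'.2.1.trans h.2.1, h.2.2.trans h'.2.2⟩

theorem par (h : Similar S P P') (h' : Similar S Q Q') : Similar S (.par P Q) (.par P' Q') := by
  have half : ∀ {P Q P' Q' : Proc A}, Covers S P.reps P'.reps → Covers S Q.reps Q'.reps →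
      Covers S (Proc.par P Q).reps (Proc.par P' Q').reps := by
    intro P Q P' Q' h h' a f hf
    rcases Proc.mem_reps_par.1 hf with hf | hf
    · exact (h a f hf).imp fun g hg => ⟨Proc.mem_reps_par.2 (Or.inl hg.1), hg.2⟩
    · exact (h' a f hf).imp fun g hg => ⟨Proc.mem_reps_par.2 (Or.inr hg.1), hg.2⟩
  exact ⟨half h.1 h'.1, half h.2.1 h'.2.1, h.2.2.add h'.2.2⟩

theorem rep (a : A) {F G : FProc A} (h : RBis S S F.cls G.cls) :
    Similar S (.rep a F) (.rep a G) := by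
  have half : ∀ {F G : FProc A}, RBis S S F.cls G.cls →
      Covers S (Proc.rep a F).reps (Proc.rep a G).reps := by
    intro F G h b f hf
    obtain ⟨rfl, rfl⟩ := Prod.mk.inj (Finset.mem_singleton.1 hf)
    exact ⟨G.cls, Finset.mem_singleton_self _, h⟩
  exact ⟨half h, half h.symm, RBis.refl _ _⟩

theorem toProc {F G : FProc A} (h : RBis S S F.cls G.cls) : Similar S F.toProc G.toProc := by
  refine ⟨?_, ?_, ?_⟩
  · rw [F.reps_toProc, G.reps_toProc]; exact Covers.refl _ _
  · rw [F.reps_toProc, G.reps_toProc]; exact Covers.refl _ _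
  · rwa [F.fin_toProc, G.fin_toProc]

/-- Used with the rewriting index as `Q`: similarity relative to the target's own replications is
enough for bisimilarity with the target. -/
theorem bisimilar (h : Similar Q.reps P Q) : Bisimilar P Q :=
  bisimilar_iff.2 (((h.2.1.rBis h.1).of_zero_zero P.fin).symm.trans h.2.2)

end Similar

theorem Bisimilar.similar {P Q : Proc A} (h : Bisimilar P Q) : Similar P.reps P Q := by
  have h' := bisimilar_iff.1 h
  have h0 := h'.zero_zero
  exact ⟨h0.covers.1, h0.covers.2, h'.trans (h0.of_zero_zero _).symm⟩

theorem Bisimilar.symm {P Q : Proc A} (h : Bisimilar P Q) : Bisimilar Q P :=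
  bisimilar_iff.2 (bisimilar_iff.1 h).symm

theorem Bisimilar.trans {P Q R : Proc A} (h : Bisimilar P Q) (h' : Bisimilar Q R) :
    Bisimilar P R :=
  bisimilar_iff.2 ((bisimilar_iff.1 h).trans (bisimilar_iff.1 h'))

theorem FCtx.rBis_fill {S : Finset (A × FClass A)} {F G : FProc A} (h : RBis S S F.cls G.cls)
    (D : FCtx A) : RBis S S (D.fill F).cls (D.fill G).cls := by
  induction D with
  | hole => exact h
  | pre a D ih => exact RBis.pre a ih
  | par D H ih => exact ih.add_right H.cls

theorem Ctx.similar_fill {S : Finset (A × FClass A)} {F G : FProc A} (h : RBis S S F.cls G.cls)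
    (C : Ctx A) : Similar S (C.fill F) (C.fill G) := by
  induction C with
  | fin D => exact Similar.toProc (D.rBis_fill h)
  | rep a D => exact Similar.rep a (D.rBis_fill h)
  | par C P ih => exact ih.par (Similar.of_eq rfl rfl)

theorem Axm.similar {T P Q : Proc A} (h : Axm T P Q) : Similar T.reps P Q := by
  cases h with
  | b1 C a F R =>
    exact C.similar_fill (RBis.pre_zero_iff.2
      ⟨F.cls, Proc.mem_reps_par.2 (Or.inl (Finset.mem_singleton_self _)), RBis.refl _ _⟩)
  | b2 a F R =>
    exact Similar.of_eq (by simp only [Proc.reps, Finset.union_idempotent])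
      (by simp only [Proc.fin, add_zero])

theorem Rews.similar {T P Q : Proc A} (h : Rews T P Q) : Similar T.reps P Q := by
  induction h with
  | refl => exact Similar.of_eq rfl rfl
  | tail _ h ih =>
    refine ih.trans ?_
    rcases h with h | ⟨T₀, P₀, Q₀, hT, hP, h, hQ⟩
    · exact Similar.of_eq h.reps_fin.1 h.reps_fin.2
    · have := h.similar
      rw [← hT.reps_fin.1] at this
      exact (Similar.of_eq hP.reps_fin.1 hP.reps_fin.2).trans
        (this.trans (Similar.of_eq hQ.reps_fin.1 hQ.reps_fin.2))

/-- Convertible processes are bisimilar. -/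
theorem Convertible.bisimilar {P Q : Proc A} : Convertible P Q → Bisimilar P Q :=
  fun ⟨_, hP, hQ⟩ => hP.similar.bisimilar.trans hQ.similar.bisimilar.symm

end Soundness

/-! ### Completeness: bisimilar processes rewrite to a common reduced form. -/

section Completeness

variable {A : Type*}

/-- Plugging a context into the hole of a finite context. -/
def FCtx.comp : FCtx A → FCtx A → FCtx A
  | .hole, E => E
  | .pre a D, E => .pre a (D.comp E)
  | .par D F, E => .par (D.comp E) F

/-- Plugging a finite context into the hole of a context. -/
def Ctx.comp : Ctx A → FCtx A → Ctx A
  | .fin D, E => .fin (D.comp E)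
  | .rep a D, E => .rep a (D.comp E)
  | .par C P, E => .par (C.comp E) P

theorem FCtx.fill_comp (D E : FCtx A) (F : FProc A) : (D.comp E).fill F = D.fill (E.fill F) := by
  induction D with
  | hole => rfl
  | pre a D ih => rw [FCtx.comp, FCtx.fill, FCtx.fill, ih]
  | par D G ih => rw [FCtx.comp, FCtx.fill, FCtx.fill, ih]

theorem Ctx.fill_comp (C : Ctx A) (E : FCtx A) (F : FProc A) :
    (C.comp E).fill F = C.fill (E.fill F) := by
  induction C with
  | fin D => rw [Ctx.comp, Ctx.fill, Ctx.fill, D.fill_comp]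
  | rep a D => rw [Ctx.comp, Ctx.fill, Ctx.fill, D.fill_comp]
  | par C P ih => rw [Ctx.comp, Ctx.fill, Ctx.fill, ih]

theorem FCtx.eqD_fill {F G : FProc A} (h : EqD F.toProc G.toProc) (D : FCtx A) :
    EqD (D.fill F).toProc (D.fill G).toProc := by
  induction D with
  | hole => exact h
  | pre a D ih => exact EqD.pre a ih
  | par D H ih => exact ih.par (EqD.refl _)

theorem Ctx.eqD_fill {F G : FProc A} (h : EqD F.toProc G.toProc) (C : Ctx A) :
    EqD (C.fill F) (C.fill G) := by
  induction C with
  | fin D => exact D.eqD_fill h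
  | rep a D => exact EqD.rep a (D.eqD_fill h)
  | par C P ih => exact ih.par (EqD.refl _)

theorem Rew.par_right {T P Q : Proc A} (h : Rew T P Q) (R : Proc A) :
    Rew T (.par P R) (.par Q R) := by
  obtain ⟨T₀, P₀, Q₀, hT, hP, h, hQ⟩ := h
  cases h with
  | b1 C a F P =>
    exact ⟨_, _, _, hT, hP.par (EqD.refl R), Axm.b1 (.par C R) a F P, hQ.par (EqD.refl R)⟩
  | b2 a F P =>
    exact ⟨_, _, _, hT, (hP.par (EqD.refl R)).trans (EqD.par_assoc _ _ _),
      Axm.b2 a F (.par P R) T₀, (EqD.par_assoc _ _ _).symm.trans (hQ.par (EqD.refl R))⟩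

namespace Rews

variable {T P Q R P' Q' : Proc A}

theorem of_eqD (h : EqD P Q) : Rews T P Q := .single (Or.inl h)

theorem of_rew (h : Rew T P Q) : Rews T P Q := .single (Or.inr h)

theorem trans (h : Rews T P Q) (h' : Rews T Q R) : Rews T P R := Relation.ReflTransGen.trans h h'

theorem par_right (h : Rews T P Q) (R : Proc A) : Rews T (.par P R) (.par Q R) := by
  induction h with
  | refl => exact .refl
  | tail _ h ih => exact ih.tail (h.imp (fun h => h.par (EqD.refl R)) fun h => h.par_right R)

theorem par_left (h : Rews T P Q) (R : Proc A) : Rews T (.par R P) (.par R Q) :=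
  (of_eqD (EqD.par_comm _ _)).trans ((h.par_right R).trans (of_eqD (EqD.par_comm _ _)))

theorem par (h : Rews T P P') (h' : Rews T Q Q') : Rews T (.par P Q) (.par P' Q') :=
  (h.par_right Q).trans (h'.par_left P')

end Rews

/-- The hypothesis asks the index to contain, for each element of `S`, an equivalent replicated
prefix with reduced body. Erasing from the inside out makes the body of an absorbed prefix reduced
too, so that (B1) applies modulo ≡. -/
theorem Rews.fill_reduce {S : Finset (A × FClass A)} {T : Proc A}
    (hT : ∀ a f, (a, f) ∈ S → ∃ G R, EqD T (.par (.rep a G) R) ∧ Reduced S G ∧ RBis S S f G.cls)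
    (F : FProc A) (C : Ctx A) : Rews T (C.fill F) (C.fill (F.reduce S)) := by
  induction F generalizing C with
  | nil => exact .refl
  | pre a F ih =>
    have h := ih (C.comp (.pre a .hole))
    rw [C.fill_comp, C.fill_comp] at h
    rw [FProc.reduce]
    split_ifs with ha
    · refine h.trans (Rews.of_rew ?_)
      obtain ⟨f, hf, e⟩ := RBis.pre_zero_iff.1 ha
      obtain ⟨G, R, hTG, hG, e'⟩ := hT a f hf
      -- Both bodies are reduced and bisimilar beside `S`, hence bisimilar and therefore ≡-equal.
      have hFG := (F.reduced_reduce S).cls_eq hG ((F.rBis_reduce S).symm.trans (e.trans e'))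
      exact ⟨_, _, _, hTG.trans ((EqD.rep a (eqD_of_cls_eq hFG.symm)).par (EqD.refl R)),
        EqD.refl _, Axm.b1 C a _ R, EqD.refl _⟩
    · exact h
  | par F G ihF ihG =>
    have h1 := ihF (C.comp (.par .hole G))
    have h2 := ihG (C.comp (.par .hole (F.reduce S)))
    rw [C.fill_comp, C.fill_comp] at h1 h2
    -- Finite contexts have their hole on the left of a parallel composition only, so the right
    -- component is reached by commutativity.
    have hc : ∀ F G : FProc A, Rews T (C.fill (.par F G)) (C.fill (.par G F)) := fun F G =>
      Rews.of_eqD (Ctx.eqD_fill (F := .par F G) (G := .par G F) (EqD.par_comm _ _) C)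
    exact h1.trans ((hc _ _).trans (h2.trans (hc _ _)))

/-- Erase all absorbed subterms of a process that are not replicated. -/
noncomputable def Proc.reduce (S : Finset (A × FClass A)) : Proc A → Proc A
  | .nil => .nil
  | .pre a F => ((FProc.pre a F).reduce S).toProc
  | .rep a F => .rep a (F.reduce S)
  | .par P Q => .par (P.reduce S) (Q.reduce S)

theorem Rews.reduce {S : Finset (A × FClass A)} {T : Proc A}
    (hT : ∀ a f, (a, f) ∈ S → ∃ G R, EqD T (.par (.rep a G) R) ∧ Reduced S G ∧ RBis S S f G.cls)
    (P : Proc A) : Rews T P (P.reduce S) := by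
  induction P with
  | nil => exact .refl
  | pre a F => exact Rews.fill_reduce hT (.pre a F) (.fin .hole)
  | rep a F => exact Rews.fill_reduce hT F (.rep a .hole)
  | par P Q ihP ihQ => exact ihP.par ihQ

theorem Proc.similar_reduce (S : Finset (A × FClass A)) (P : Proc A) :
    Similar S P (P.reduce S) := by
  induction P with
  | nil => exact Similar.of_eq rfl rfl
  | pre a F => exact Similar.toProc ((FProc.pre a F).rBis_reduce S)
  | rep a F => exact Similar.rep a (F.rBis_reduce S)
  | par P Q ihP ihQ => exact ihP.par ihQ

theorem Proc.exists_reduced_fin (S : Finset (A × FClass A)) (P : Proc A) :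
    ∃ F, Reduced S F ∧ F.cls = (P.reduce S).fin := by
  induction P with
  | nil => exact ⟨.nil, trivial, rfl⟩
  | pre a F => exact ⟨_, (FProc.pre a F).reduced_reduce S, (FProc.fin_toProc _).symm⟩
  | rep a F => exact ⟨.nil, trivial, rfl⟩
  | par P Q ihP ihQ =>
    obtain ⟨F, hF, e⟩ := ihP
    obtain ⟨G, hG, e'⟩ := ihQ
    exact ⟨.par F G, ⟨hF, hG⟩, by rw [FProc.cls_par, e, e']; rfl⟩

theorem Proc.exists_reduced_rep {S : Finset (A × FClass A)} {P : Proc A} {a : A} {f : FClass A}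
    (h : (a, f) ∈ (P.reduce S).reps) : ∃ F, Reduced S F ∧ F.cls = f := by
  induction P with
  | nil => exact absurd h (Finset.notMem_empty _)
  | pre b F =>
    rw [Proc.reduce, FProc.reps_toProc] at h
    exact absurd h (Finset.notMem_empty _)
  | rep b F =>
    obtain ⟨rfl, rfl⟩ := Prod.mk.inj (Finset.mem_singleton.1 h)
    exact ⟨_, F.reduced_reduce S, rfl⟩
  | par P Q ihP ihQ =>
    rcases Proc.mem_reps_par.1 h with h | h
    exacts [ihP h, ihQ h]

/-- After reduction all data are represented by reduced finite processes, for which bisimilarity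
beside `S` becomes equality of classes. -/
theorem Proc.reduce_eq_of_similar {S : Finset (A × FClass A)} {P Q : Proc A}
    (h : Similar S P Q) :
    (P.reduce S).reps = (Q.reduce S).reps ∧ (P.reduce S).fin = (Q.reduce S).fin := by
  have h' := (P.similar_reduce S).symm.trans (h.trans (Q.similar_reduce S))
  have half : ∀ {P Q : Proc A}, Covers S (P.reduce S).reps (Q.reduce S).reps →
      (P.reduce S).reps ⊆ (Q.reduce S).reps := by
    rintro P Q h ⟨a, f⟩ hf
    obtain ⟨g, hg, e⟩ := h a f hf
    obtain ⟨F, hF, rfl⟩ := Proc.exists_reduced_rep hf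
    obtain ⟨G, hG, rfl⟩ := Proc.exists_reduced_rep hg
    rwa [hF.cls_eq hG e]
  refine ⟨(half h'.1).antisymm (half h'.2.1), ?_⟩
  obtain ⟨F, hF, e⟩ := P.exists_reduced_fin S
  obtain ⟨G, hG, e'⟩ := Q.exists_reduced_fin S
  have := h'.2.2
  rw [← e, ← e'] at this ⊢
  exact hF.cls_eq hG this

/-- The parallel composition of the replicated prefixes in `S`. -/
noncomputable def repProc (S : Finset (A × FClass A)) : Proc A :=
  parList (S.toList.map fun p => .rep p.1 p.2.out)

theorem repProc_insert {S : Finset (A × FClass A)} {p : A × FClass A} (hp : p ∉ S) :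
    EqD (repProc (insert p S)) (.par (.rep p.1 p.2.out) (repProc S)) :=
  parList_perm ((Finset.toList_insert hp).map _)

theorem exists_eqD_repProc {S : Finset (A × FClass A)} {p : A × FClass A} (hp : p ∈ S) :
    ∃ R, EqD (repProc S) (.par (.rep p.1 p.2.out) R) := by
  refine ⟨repProc (S.erase p), ?_⟩
  conv => arg 1; rw [← Finset.insert_erase hp]
  exact repProc_insert (Finset.notMem_erase _ _)

/-- A prefix already present is merged by (B2); this is how a parallel composition of replications
becomes a set. -/
theorem Rews.repProc_insert (T : Proc A) (p : A × FClass A) (S : Finset (A × FClass A)) :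
    Rews T (.par (.rep p.1 p.2.out) (repProc S)) (repProc (insert p S)) := by
  by_cases hp : p ∈ S
  · rw [Finset.insert_eq_of_mem hp]
    obtain ⟨R, hR⟩ := exists_eqD_repProc hp
    exact Rews.of_rew ⟨T, _, _, EqD.refl T,
      ((EqD.refl _).par hR).trans (EqD.par_assoc _ _ _).symm, Axm.b2 p.1 p.2.out R T, hR.symm⟩
  · exact Rews.of_eqD (CCS.repProc_insert hp).symm

theorem Rews.repProc_union (T : Proc A) (S S' : Finset (A × FClass A)) :
    Rews T (.par (repProc S) (repProc S')) (repProc (S ∪ S')) := by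
  induction S using Finset.induction_on with
  | empty =>
    rw [Finset.empty_union]
    refine Rews.of_eqD ?_
    rw [repProc, Finset.toList_empty]
    exact EqD.nil_par _
  | insert p S hp ih =>
    rw [Finset.insert_union]
    exact (Rews.of_eqD (((CCS.repProc_insert hp).par (EqD.refl _)).trans
      (EqD.par_assoc _ _ _))).trans ((ih.par_left _).trans (Rews.repProc_insert T p _))

/-- The canonical process with a given finite part and given replicated prefixes. -/
noncomputable def canonical (x : FClass A) (S : Finset (A × FClass A)) : Proc A :=
  .par x.out.toProc (repProc S)

theorem EqD.out_cls (F : FProc A) : EqD F.toProc F.cls.out.toProc :=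
  eqD_of_cls_eq (FClass.cls_out _).symm

theorem EqD.canonical_empty (F : FProc A) : EqD F.toProc (canonical F.cls ∅) := by
  rw [canonical, repProc, Finset.toList_empty]
  exact (EqD.out_cls F).trans (EqD.par_nil _).symm

theorem Rews.canonical (T P : Proc A) : Rews T P (canonical P.fin P.reps) := by
  induction P with
  | nil => exact Rews.of_eqD (EqD.canonical_empty .nil)
  | pre a F => exact Rews.of_eqD (EqD.canonical_empty (.pre a F))
  | rep a F =>
    refine Rews.of_eqD ?_
    rw [Proc.reps, CCS.canonical, repProc, Finset.toList_singleton]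
    exact (EqD.rep a (EqD.out_cls F)).trans ((EqD.par_nil _).symm.trans
      ((EqD.nil_par _).symm.trans ((EqD.out_cls .nil).par (EqD.refl _))))
  | par P Q ihP ihQ =>
    have h : EqD (.par P.fin.out.toProc Q.fin.out.toProc) (P.fin + Q.fin).out.toProc :=
      eqD_of_cls_eq (F := .par P.fin.out Q.fin.out) (by
        rw [FProc.cls_par, FClass.cls_out, FClass.cls_out, FClass.cls_out])
    exact (ihP.par ihQ).trans ((Rews.of_eqD ((EqD.par_par_comm _ _ _ _).trans
      (h.par (EqD.refl _)))).trans ((Rews.repProc_union T _ _).par_left _))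

/-- Bisimilar processes are convertible. -/
theorem Bisimilar.convertible {P Q : Proc A} (h : Bisimilar P Q) : Convertible P Q := by
  have hPQ := Proc.reduce_eq_of_similar h.similar
  -- The common target serves as the index: it replicates the reduced form of every replicated
  -- prefix of `P`, which is all that the erasures in both `P` and `Q` need.
  have hT : ∀ a f, (a, f) ∈ P.reps → ∃ G R,
      EqD (canonical (P.reduce P.reps).fin (P.reduce P.reps).reps) (.par (.rep a G) R) ∧
        Reduced P.reps G ∧ RBis P.reps P.reps f G.cls := by
    intro a f hf
    obtain ⟨g, hg, e⟩ := (P.similar_reduce P.reps).1 a f hf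
    obtain ⟨G, hG, rfl⟩ := Proc.exists_reduced_rep hg
    obtain ⟨R, hR⟩ := exists_eqD_repProc hg
    refine ⟨G, _, ((EqD.refl _).par (hR.trans
      ((EqD.rep a (EqD.out_cls G).symm).par (EqD.refl R)))).trans (EqD.par_left_comm _ _ _), hG, e⟩
  refine ⟨_, (Rews.reduce hT P).trans (Rews.canonical _ _), ?_⟩
  have hQ := (Rews.reduce hT Q).trans (Rews.canonical _ _)
  rwa [← hPQ.1, ← hPQ.2] at hQ

end Completeness
end CCS

theorem mainTheorem1 {A : Type*} [Countable A] (P Q : CCS.Proc A) :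
    CCS.Convertible P Q ↔ CCS.Bisimilar P Q :=
  ⟨CCS.Convertible.bisimilar, CCS.Bisimilar.convertible⟩
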